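/- **Proposition 7.4.** Let $G$ be a Poisson Lie group with Lie algebra $\mathfrak g$, let $[\,\cdot,\cdot\,]_*$ be the bracket on $\mathfrak g^*$ obtained by linearizing the Poisson structure of $G$ at the identity, and let $M$ be a nonempty Poisson manifold with a Poisson action of $G$ (i.e. the action map $G\times M\to M$ is a Poisson map for the product Poisson structure). Let $H\subseteq G$ be a closed subgroup with Lie algebra $h\subseteq\mathfrak g$ and annihilator $h^\perp\subseteq\mathfrak g^*$. For $X\in\mathfrak g$ let $X_M$ be the vector field on $M$ given by the infinitesimal action. Assume that the tangent spaces $\mathfrak h_x=\{X_M(x): X\in h\}$ of the $H$-orbits have locally constant rank, so that they form a distribution $\mathfrak h\subseteq TM$, and let $\mathfrak h^\perp\subseteq T^*M$ be its annihilator. Let $T^*M$ carry the cotangent Lie algebroid structure of the Poisson manifold $M$. 1. If $h^\perp$ is a subalgebra of $\mathfrak g^*$, then $\mathfrak h^\perp$ is a Lie subalgebroid of $T^*M$. Consequently the Poisson structure descends to the quotient, in the following sense. - If $U\subseteq M$ is open and $f,g\in C^\infty(U)$ satisfy $df|_{\mathfrak h}=dg|_{\mathfrak h}=0$, then $d\{f,g\}|_{\mathfrak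 h}=0$ on $U$. - If $U\subseteq M$ is open and $q:U\to N$ is a surjective submersion onto a (Hausdorff) manifold $N$ with connected fibres and $\ker dq=\mathfrak h|_U$, then there is a unique Poisson structure on $N$ for which $q$ is a Poisson map. - If $H$ is connected and $M/H$ is a (Hausdorff) manifold such that the projection $p:M\to M/H$ is a submersion whose vertical distribution $\ker dp$ is $\mathfrak h$, then there is a unique Poisson structure on $M/H$ for which $p$ is a Poisson map. 2. Conversely, suppose that for every $x\in M$ the isotropy subalgebra $\{X\in\mathfrak g: X_M(x)=0\}$ is contained in $h$; this holds in particular if the action is locally free, i.e. if all isotropy subalgebras are zero. If $\mathfrak h^\perp$ is a Lie subalgebroid of $T^*M$, then $h^\perp$ is a subalgebra of $\mathfrak g^*$. -/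

import Mathlib

open scoped Manifold ContDiff

noncomputable section

namespace PoissonReduction

/-! ### One-forms -/

section Forms

variable {E : Type*} [NormedAddCommGroup E] [NormedSpace ℝ E]
  {H : Type*} [TopologicalSpace H] (I : ModelWithCorners ℝ E H)
  {M : Type*} [TopologicalSpace M] [ChartedSpace H M]

/-- The cotangent space `T*_x M`. -/
abbrev Cotangent (x : M) : Type _ := TangentSpace I x →L[ℝ] ℝ

variable (M) in
/-- A field of covectors (a not necessarily smooth one-form) on `M`. -/
abbrev CovectorField : Type _ := ∀ x : M, Cotangent I x

/-- The annihilator `W^⊥ ⊆ T*_x M` of a subspace `W ⊆ T_x M`. -/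
def annihilator {x : M} (W : Submodule ℝ (TangentSpace I x)) : Submodule ℝ (Cotangent I x) where
  carrier := {a | ∀ v ∈ W, a v = 0}
  add_mem' := fun ha hb v hv => by simp [ha v hv, hb v hv]
  zero_mem' := fun v _ => by simp
  smul_mem' := fun c a ha v hv => by simp [ha v hv]

/-- A bivector field `π` on `M`, given at every point by the linear map `π^♯ : T*_x M → T_x M`, where `π (a, b) = b (π^♯ a)`.  Skew-symmetry and smoothness are
part of `IsPoisson` below. -/
abbrev BivectorField (M : Type*) [TopologicalSpace M] [ChartedSpace H M] : Type _ :=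
  ∀ x : M, Cotangent I x →ₗ[ℝ] TangentSpace I x

variable {I}

/-- The bracket `{f, g} = π (df, dg)` of two functions. -/
def bracket (π : BivectorField I M) (f g : M → ℝ) (x : M) : ℝ :=
  mvfderiv I g x (π x (mvfderiv I f x))

/-- `π` is a (smooth) Poisson structure: it is skew-symmetric, brackets of smooth functions are
smooth, and the bracket satisfies the Jacobi identity. -/
structure IsPoisson (π : BivectorField I M) : Prop where
  alternating : ∀ (x : M) (a : Cotangent I x), a (π x a) = 0
  smooth : ∀ f g : M → ℝ, ContMDiff I 𝓘(ℝ, ℝ) ∞ f → ContMDiff I 𝓘(ℝ, ℝ) ∞ g →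
    ContMDiff I 𝓘(ℝ, ℝ) ∞ (bracket π f g)
  jacobi : ∀ f g h : M → ℝ, ContMDiff I 𝓘(ℝ, ℝ) ∞ f → ContMDiff I 𝓘(ℝ, ℝ) ∞ g →
    ContMDiff I 𝓘(ℝ, ℝ) ∞ h → ∀ x,
      bracket π f (bracket π g h) x + bracket π g (bracket π h f) x
        + bracket π h (bracket π f g) x = 0

variable {E' : Type*} [NormedAddCommGroup E'] [NormedSpace ℝ E']
  {H' : Type*} [TopologicalSpace H'] {J : ModelWithCorners ℝ E' H'}
  {N : Type*} [TopologicalSpace N] [ChartedSpace H' N]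

/-- The map `φ` relates `πM` at `x` to `πN` at `φ x`: `πN^♯ = dφ ∘ πM^♯ ∘ dφ*`, equivalently
`πN (a, b) = πM (φ* a, φ* b)`. -/
def PoissonRelatedAt (πM : BivectorField I M) (πN : BivectorField J N) (φ : M → N) (x : M) :
    Prop :=
  ∀ a : Cotangent J (φ x),
    πN (φ x) a = mfderiv I J φ x (πM x (a.comp (mfderiv I J φ x)))

/-- Poisson maps: smooth maps which relate the two bivector fields at every point. -/
structure IsPoissonMap (πM : BivectorField I M) (πN : BivectorField J N) (φ : M → N) : Prop where
  smooth : ContMDiff I J ∞ φ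
  related : ∀ x, PoissonRelatedAt πM πN φ x

/-- Restriction of a covector at `p = (x, y)` to the summand `T_x M` of
`T_p (M × N) = T_x M × T_y N`. -/
def cotangentFst (p : M × N) : Cotangent (I.prod J) p →ₗ[ℝ] Cotangent I p.1 where
  toFun a := (show E × E' →L[ℝ] ℝ from a).comp (ContinuousLinearMap.inl ℝ E E')
  map_add' _ _ := rfl
  map_smul' _ _ := rfl

/-- Restriction of a covector at `p = (x, y)` to the summand `T_y N` of
`T_p (M × N) = T_x M × T_y N`. -/
def cotangentSnd (p : M × N) : Cotangent (I.prod J) p →ₗ[ℝ] Cotangent J p.2 where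
  toFun a := (show E × E' →L[ℝ] ℝ from a).comp (ContinuousLinearMap.inr ℝ E E')
  map_add' _ _ := rfl
  map_smul' _ _ := rfl

/-- The bivector field of the product Poisson structure on `M × N`. -/
def prodBivector (πM : BivectorField I M) (πN : BivectorField J N) :
    BivectorField (I.prod J) (M × N) := fun p =>
  ((πM p.1).comp (cotangentFst p)).prod ((πN p.2).comp (cotangentSnd p))

/-- `G`, with the bivector field `πG`, is a Poisson Lie group: `πG` is Poisson and multiplication
`G × G → G` is a Poisson map. -/
structure IsPoissonLie {G : Type*} [TopologicalSpace G] [ChartedSpace H G] [Group G]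
    (πG : BivectorField I G) : Prop where
  isPoisson : IsPoisson πG
  mul : IsPoissonMap (prodBivector πG πG) πG (fun p : G × G => p.1 * p.2)

/-- The action of `G` on `M` is a Poisson action: `σ : G × M → M` is a Poisson map. -/
def IsPoissonAction {G : Type*} [TopologicalSpace G] [ChartedSpace H G] [SMul G N]
    (πG : BivectorField I G) (πN : BivectorField J N) : Prop :=
  IsPoissonMap (prodBivector πG πN) πN (fun p : G × N => p.1 • p.2)

end Forms

/-! ### The cotangent Lie algebroid of a Poisson manifold -/

section Algebroid

variable {E : Type*} [NormedAddCommGroup E] [NormedSpace ℝ E]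
  {M : Type*} [TopologicalSpace M] [ChartedSpace E M]

/-- Smoothness of a one-form, as a section of the cotangent bundle. -/
def IsSmoothForm [IsManifold 𝓘(ℝ, E) ∞ M] (α : CovectorField 𝓘(ℝ, E) M) : Prop :=
  ContMDiff 𝓘(ℝ, E) (𝓘(ℝ, E).prod 𝓘(ℝ, E →L[ℝ] ℝ)) ∞
    (fun x => Bundle.TotalSpace.mk' (E →L[ℝ] ℝ) x (α x))

/-- The one-form `α` pulled back to the model space `E` by the inverse of the preferred chart
at `x`. -/
def formInChart (α : CovectorField 𝓘(ℝ, E) M) (x : M) (e : E) : E →L[ℝ] ℝ :=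
  (α ((extChartAt 𝓘(ℝ, E) x).symm e)).comp
    (mfderiv 𝓘(ℝ, E) 𝓘(ℝ, E) (extChartAt 𝓘(ℝ, E) x).symm e)

/-- The exterior derivative `dα` at `x`, as the bilinear form `(u, v) ↦ dα (u, v)`.  It is computed
in the preferred chart at `x`, through which Mathlib identifies `T_x M` with `E`. -/
def extD (α : CovectorField 𝓘(ℝ, E) M) (x : M) :
    TangentSpace 𝓘(ℝ, E) x →L[ℝ] Cotangent 𝓘(ℝ, E) x :=
  letI A : E →L[ℝ] E →L[ℝ] ℝ :=
    fderiv ℝ (formInChart α x) (extChartAt 𝓘(ℝ, E) x x)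
  (A - A.flip : E →L[ℝ] E →L[ℝ] ℝ)

/-- The Lie algebroid bracket on one-forms of a Poisson manifold,
`[α, β] = L_{π^♯ α} β - L_{π^♯ β} α - d (π (α, β))
        = dβ (π^♯ α, ·) - dα (π^♯ β, ·) + d (π (α, β))`. -/
def formBracket (π : BivectorField 𝓘(ℝ, E) M) (α β : CovectorField 𝓘(ℝ, E) M) :
    CovectorField 𝓘(ℝ, E) M := fun x =>
  extD β x (π x (α x)) - extD α x (π x (β x))
    + mvfderiv 𝓘(ℝ, E) (fun y => β y (π y (α y))) x

/-- A family `B` of subspaces of the cotangent spaces is a subalgebroid of the cotangent algebroid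
of `(M, π)`: it is a smooth subbundle (the rank is locally constant, and through every element
passes a smooth section), and its smooth sections are closed under the bracket. -/
structure IsSubalgebroid [IsManifold 𝓘(ℝ, E) ∞ M] (π : BivectorField 𝓘(ℝ, E) M)
    (B : ∀ x : M, Submodule ℝ (Cotangent 𝓘(ℝ, E) x)) : Prop where
  locallyConstant_rank : IsLocallyConstant (fun x => Module.finrank ℝ (B x))
  exists_section : ∀ (x : M), ∀ a ∈ B x, ∃ α : CovectorField 𝓘(ℝ, E) M,
    IsSmoothForm α ∧ (∀ y, α y ∈ B y) ∧ α x = a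
  closed : ∀ α β : CovectorField 𝓘(ℝ, E) M, IsSmoothForm α → IsSmoothForm β →
    (∀ y, α y ∈ B y) → (∀ y, β y ∈ B y) → ∀ y, formBracket π α β y ∈ B y

/-- `q : U → N` exhibits the manifold `N` as the quotient of the open set `U ⊆ M` by the
distribution `D`: it is a surjective submersion whose fibres are connected and tangent to `D`. -/
structure IsDistributionQuotient {E' : Type*} [NormedAddCommGroup E'] [NormedSpace ℝ E']
    {N : Type*} [TopologicalSpace N] [ChartedSpace E' N]
    (D : ∀ x : M, Submodule ℝ (TangentSpace 𝓘(ℝ, E) x)) (U : Set M) (q : M → N) : Prop where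
  isOpen : IsOpen U
  smooth : ContMDiffOn 𝓘(ℝ, E) 𝓘(ℝ, E') ∞ q U
  surjective : ∀ y, ∃ x ∈ U, q x = y
  submersion : ∀ x ∈ U, Function.Surjective (mfderiv 𝓘(ℝ, E) 𝓘(ℝ, E') q x)
  ker_eq : ∀ x ∈ U, ∀ v : TangentSpace 𝓘(ℝ, E) x,
    mfderiv 𝓘(ℝ, E) 𝓘(ℝ, E') q x v = 0 ↔ v ∈ D x
  connected_fibre : ∀ y, IsConnected (U ∩ q ⁻¹' {y})

end Algebroid

/-! ### Lie groups and actions -/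

section Group

variable {E : Type*} [NormedAddCommGroup E] [NormedSpace ℝ E]
  {G : Type*} [TopologicalSpace G] [ChartedSpace E G] [Group G]

/-- The Lie algebra `{X ∈ 𝔤 | exp (t X) ∈ K for all t}` of a closed subgroup `K` of `G`; the curves
`t ↦ exp (t X)` are the smooth one-parameter subgroups with velocity `X` at `0`.  (This set is a
linear subspace; the span only records this.) -/
def subgroupLieAlgebra (K : Subgroup G) : Submodule ℝ (GroupLieAlgebra 𝓘(ℝ, E) G) :=
  Submodule.span ℝ {X | ∃ γ : ℝ → G, ContMDiff 𝓘(ℝ, ℝ) 𝓘(ℝ, E) ∞ γ ∧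
    (∀ s t, γ (s + t) = γ s * γ t) ∧ (∀ t, γ t ∈ K) ∧
    (mfderiv 𝓘(ℝ, ℝ) 𝓘(ℝ, E) γ 0 (1 : ℝ) : E) = X}

/-- The left-invariant one-form on `G` with value `ξ ∈ 𝔤*` at the identity. -/
def leftInvariantForm (ξ : Cotangent 𝓘(ℝ, E) (1 : G)) : CovectorField 𝓘(ℝ, E) G := fun g =>
  (show E →L[ℝ] ℝ from ξ).comp
    (show TangentSpace 𝓘(ℝ, E) g →L[ℝ] E from mfderiv 𝓘(ℝ, E) 𝓘(ℝ, E) (fun k : G => g⁻¹ * k) g)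

/-- The bracket on `𝔤*` of the tangent Lie bialgebra of a Poisson Lie group: the linearization
of `πG` at the identity, i.e. `[ξ, η]_* = d_1 (πG (ξ', η'))` where `ξ'`, `η'` are the left-invariant
one-forms extending `ξ`, `η`. -/
def dualBracket (πG : BivectorField 𝓘(ℝ, E) G) (ξ η : Cotangent 𝓘(ℝ, E) (1 : G)) :
    Cotangent 𝓘(ℝ, E) (1 : G) :=
  mvfderiv 𝓘(ℝ, E) (fun g => leftInvariantForm η g (πG g (leftInvariantForm ξ g))) 1

/-- A subspace of `𝔤*` is a subalgebra: it is closed under the bracket of `𝔤*`. -/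
def IsDualSubalgebra (πG : BivectorField 𝓘(ℝ, E) G)
    (S : Submodule ℝ (Cotangent 𝓘(ℝ, E) (1 : G))) : Prop :=
  ∀ ξ ∈ S, ∀ η ∈ S, dualBracket πG ξ η ∈ S

variable {F : Type*} [NormedAddCommGroup F] [NormedSpace ℝ F]
  {M : Type*} [TopologicalSpace M] [ChartedSpace F M] [MulAction G M]

/-- The infinitesimal action `𝔤 → T_x M`, `X ↦ d/dt|₀ exp (t X) • x`, that is, the derivative at
the identity of the orbit map `g ↦ g • x`. -/
def infinitesimalAction (E : Type*) [NormedAddCommGroup E] [NormedSpace ℝ E]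
    (F : Type*) [NormedAddCommGroup F] [NormedSpace ℝ F]
    (G : Type*) [TopologicalSpace G] [ChartedSpace E G] [Group G]
    {M : Type*} [TopologicalSpace M] [ChartedSpace F M] [MulAction G M] (x : M) :
    GroupLieAlgebra 𝓘(ℝ, E) G →ₗ[ℝ] TangentSpace 𝓘(ℝ, F) x where
  toFun X := (mfderiv 𝓘(ℝ, E) 𝓘(ℝ, F) (fun g : G => g • x) 1 X : F)
  map_add' X Y := map_add (mfderiv 𝓘(ℝ, E) 𝓘(ℝ, F) (fun g : G => g • x) 1) X Y
  map_smul' c X := map_smul (mfderiv 𝓘(ℝ, E) 𝓘(ℝ, F) (fun g : G => g • x) 1) c X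

/-- The isotropy subalgebra `{X ∈ 𝔤 | X_M (x) = 0}` of `x`. -/
def isotropyAlgebra (E : Type*) [NormedAddCommGroup E] [NormedSpace ℝ E]
    (F : Type*) [NormedAddCommGroup F] [NormedSpace ℝ F]
    (G : Type*) [TopologicalSpace G] [ChartedSpace E G] [Group G]
    {M : Type*} [TopologicalSpace M] [ChartedSpace F M] [MulAction G M] (x : M) :
    Submodule ℝ (GroupLieAlgebra 𝓘(ℝ, E) G) :=
  LinearMap.ker (infinitesimalAction E F G x)

/-- The tangent spaces `{X_M (x) | X ∈ Lie K}` of the `K`-orbits. -/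
def orbitDistribution (E : Type*) [NormedAddCommGroup E] [NormedSpace ℝ E]
    (F : Type*) [NormedAddCommGroup F] [NormedSpace ℝ F]
    {G : Type*} [TopologicalSpace G] [ChartedSpace E G] [Group G] (K : Subgroup G)
    {M : Type*} [TopologicalSpace M] [ChartedSpace F M] [MulAction G M] (x : M) :
    Submodule ℝ (TangentSpace 𝓘(ℝ, F) x) :=
  (subgroupLieAlgebra (E := E) K).map (infinitesimalAction E F G x)

/-- The map `p : M → N` exhibits the manifold `N` as the orbit space `M / K`, such that the
projection is a submersion: the fibres of `p` are the `K`-orbits, and their tangent spaces are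
those of the `K`-orbits. -/
structure IsOrbitQuotient {F' : Type*} [NormedAddCommGroup F'] [NormedSpace ℝ F']
    {N : Type*} [TopologicalSpace N] [ChartedSpace F' N]
    (E : Type*) [NormedAddCommGroup E] [NormedSpace ℝ E]
    (F : Type*) [NormedAddCommGroup F] [NormedSpace ℝ F]
    {G : Type*} [TopologicalSpace G] [ChartedSpace E G] [Group G] (K : Subgroup G)
    {M : Type*} [TopologicalSpace M] [ChartedSpace F M] [MulAction G M] (p : M → N) : Prop where
  smooth : ContMDiff 𝓘(ℝ, F) 𝓘(ℝ, F') ∞ p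
  surjective : Function.Surjective p
  submersion : ∀ x, Function.Surjective (mfderiv 𝓘(ℝ, F) 𝓘(ℝ, F') p x)
  fibre_eq_orbit : ∀ x y, p x = p y ↔ ∃ k ∈ K, k • x = y
  ker_eq : ∀ x, ∀ v : TangentSpace 𝓘(ℝ, F) x,
    mfderiv 𝓘(ℝ, F) 𝓘(ℝ, F') p x v = 0 ↔ v ∈ orbitDistribution E F K x

end Group

end PoissonReduction

end

open scoped Manifold ContDiff

noncomputable section

/-! Everything rests on one pointwise identity, `formBracket_orbitDeriv`. Write σ_x : 𝔤 → T_x M for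
the infinitesimal action. If one-forms α, β vanish on X_M near x, then [α, β](X_M) at x equals [σ_x*
α, σ_x* β]_*(X). To see this, split the Poisson property of the action into its two partial maps
(`IsPoissonAction.apply`): π at g • x, paired with α and β there, is π at x paired with g*α and g*β,
plus the bivector of G at g paired with the pullbacks along the orbit map. Differentiate at g = 1 in
the direction X. The left side gives X_M(π(α, β)). The first term on the right gives the Lie
derivatives of α and β, and Cartan's formula reduces these to contractions of dα and dβ, because
α(X_M) = β(X_M) = 0 near x. As the bivector of G vanishes at 1, the second term contributes only its
linearization, which is the bracket of 𝔤*. Rearranging produces the algebroid bracket.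

Given the identity, a form annihilating the orbit directions pulls back under σ_x into h^⊥. So
closure of h^⊥ yields closure of 𝔥^⊥, and, with [df, dg] = d{f, g}, closure of functions under the
bracket. Conversely, if the isotropy at x lies in h, every element of h^⊥ kills ker σ_x, hence is
σ_x* a with a in 𝔥_x^⊥. Extending such covectors to sections and applying the identity at this
single point gives closure of h^⊥.

For quotients, the bracket of two functions pulled back along q has differential vanishing on ker
dq. By the normal form of submersions it is locally constant along fibres, and connectedness makes
it constant. Thus dq ∘ π^♯ ∘ dq* depends only on q(x) and defines the bivector on N. Smoothness
follows from local sections, the Jacobi identity by pulling back, and uniqueness from surjectivity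
of q. -/

namespace PoissonReduction

open Filter Topology Set

/-! ### Calculus in the preferred charts -/

section Charts

variable {E : Type*} [NormedAddCommGroup E] [NormedSpace ℝ E]
  {M : Type*} [TopologicalSpace M] [ChartedSpace E M]

/-- The type of a covector depends on its base point, so equal points cannot simply be rewritten;
taking the vector in the model space `E` avoids this. Local facts of the form `∀ z, z = x → …` serve
the same purpose. -/
theorem covectorField_congr (α : CovectorField 𝓘(ℝ, E) M) {y z : M} (h : z = y) (v : E) :
    α z v = α y v := by
  subst h; rfl

theorem mvfderiv_congr {W : Type*} [NormedAddCommGroup W] [NormedSpace ℝ W] {f g : M → W} {x : M}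
    (h : f =ᶠ[𝓝 x] g) : mvfderiv 𝓘(ℝ, E) f x = mvfderiv 𝓘(ℝ, E) g x := by
  ext v
  exact congrArg (fun T : E →L[ℝ] W => T v) (h.mfderiv_eq (I := 𝓘(ℝ, E)) (I' := 𝓘(ℝ, W)))

theorem eventually_chart_symm {p : M → Prop} {x : M} (h : ∀ᶠ y in 𝓝 x, p y) :
    ∀ᶠ e in 𝓝 (extChartAt 𝓘(ℝ, E) x x), p ((extChartAt 𝓘(ℝ, E) x).symm e) := by
  have := (continuousAt_extChartAt_symm (I := 𝓘(ℝ, E)) x)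
  rw [ContinuousAt, extChartAt_to_inv] at this
  exact this.eventually h

theorem eventually_mem_target (x : M) :
    ∀ᶠ e in 𝓝 (extChartAt 𝓘(ℝ, E) x x), e ∈ (extChartAt 𝓘(ℝ, E) x).target :=
  extChartAt_target_mem_nhds x

theorem eventually_mem_source (x : M) :
    ∀ᶠ y in 𝓝 x, y ∈ (extChartAt 𝓘(ℝ, E) x).source :=
  extChartAt_source_mem_nhds x

variable [IsManifold 𝓘(ℝ, E) ∞ M]

theorem mdifferentiableAt_chart {x y : M} (hy : y ∈ (extChartAt 𝓘(ℝ, E) x).source) :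
    MDifferentiableAt 𝓘(ℝ, E) 𝓘(ℝ, E) (extChartAt 𝓘(ℝ, E) x) y :=
  have : IsManifold 𝓘(ℝ, E) 1 M := inferInstance
  mdifferentiableAt_extChartAt (by rwa [extChartAt_source] at hy)

theorem contMDiffAt_chart {x y : M} (hy : y ∈ (extChartAt 𝓘(ℝ, E) x).source) :
    ContMDiffAt 𝓘(ℝ, E) 𝓘(ℝ, E) ∞ (extChartAt 𝓘(ℝ, E) x) y :=
  contMDiffAt_extChartAt' (by rwa [extChartAt_source] at hy)

theorem contMDiffAt_chart_symm {x : M} {e : E} (he : e ∈ (extChartAt 𝓘(ℝ, E) x).target) :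
    ContMDiffAt 𝓘(ℝ, E) 𝓘(ℝ, E) ∞ (extChartAt 𝓘(ℝ, E) x).symm e :=
  (contMDiffOn_extChartAt_symm x).contMDiffAt ((isOpen_extChartAt_target x).mem_nhds he)

theorem mdifferentiableAt_chart_symm {x : M} {e : E} (he : e ∈ (extChartAt 𝓘(ℝ, E) x).target) :
    MDifferentiableAt 𝓘(ℝ, E) 𝓘(ℝ, E) (extChartAt 𝓘(ℝ, E) x).symm e :=
  (contMDiffAt_chart_symm he).mdifferentiableAt (by simp)

theorem mfderiv_chart_symm_mfderiv_chart {x y : M}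
    (hy : y ∈ (extChartAt 𝓘(ℝ, E) x).source) (v : E) :
    (mfderiv 𝓘(ℝ, E) 𝓘(ℝ, E) (extChartAt 𝓘(ℝ, E) x).symm (extChartAt 𝓘(ℝ, E) x y)
      (mfderiv 𝓘(ℝ, E) 𝓘(ℝ, E) (extChartAt 𝓘(ℝ, E) x) y v : E) : E) = v := by
  have : IsManifold 𝓘(ℝ, E) 1 M := inferInstance
  have h := mfderivWithin_extChartAt_symm_comp_mfderiv_extChartAt' (I := 𝓘(ℝ, E)) hy
  simp only [modelWithCornersSelf_coe, range_id, mfderivWithin_univ] at h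
  exact congrArg (fun T : E →L[ℝ] E => T v) h

/-- This is the convention identifying `T_x M` with `E`. It is what allows `extD`, computed in a
chart, to be evaluated directly on tangent vectors at `x`. -/
theorem mfderiv_chart_self (x : M) (v : E) :
    (mfderiv 𝓘(ℝ, E) 𝓘(ℝ, E) (extChartAt 𝓘(ℝ, E) x) x v : E) = v := by
  have : IsManifold 𝓘(ℝ, E) 1 M := inferInstance
  exact congrArg (fun T : E →L[ℝ] E => T v) (mfderiv_extChartAt_self (I := 𝓘(ℝ, E)) (x := x))

theorem mfderiv_chart_symm_self (x : M) (v : E) :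
    (mfderiv 𝓘(ℝ, E) 𝓘(ℝ, E) (extChartAt 𝓘(ℝ, E) x).symm (extChartAt 𝓘(ℝ, E) x x) v : E) = v :=
  (congrArg (mfderiv 𝓘(ℝ, E) 𝓘(ℝ, E) (extChartAt 𝓘(ℝ, E) x).symm (extChartAt 𝓘(ℝ, E) x x) : E → E)
    (mfderiv_chart_self x v).symm).trans
    (mfderiv_chart_symm_mfderiv_chart (mem_extChartAt_source (I := 𝓘(ℝ, E)) x) v)

theorem formInChart_mfderiv_chart (α : CovectorField 𝓘(ℝ, E) M) {x y : M}
    (hy : y ∈ (extChartAt 𝓘(ℝ, E) x).source) (v : E) :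
    formInChart α x (extChartAt 𝓘(ℝ, E) x y)
      (mfderiv 𝓘(ℝ, E) 𝓘(ℝ, E) (extChartAt 𝓘(ℝ, E) x) y v) = α y v := by
  change α _ (mfderiv 𝓘(ℝ, E) 𝓘(ℝ, E) (extChartAt 𝓘(ℝ, E) x).symm (extChartAt 𝓘(ℝ, E) x y)
      (mfderiv 𝓘(ℝ, E) 𝓘(ℝ, E) (extChartAt 𝓘(ℝ, E) x) y v : E) : E) = _
  refine (covectorField_congr α ((extChartAt 𝓘(ℝ, E) x).left_inv hy) _).trans ?_
  exact congrArg (α y : E → ℝ) (mfderiv_chart_symm_mfderiv_chart hy v)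

theorem formInChart_self (α : CovectorField 𝓘(ℝ, E) M) (x : M) :
    formInChart α x (extChartAt 𝓘(ℝ, E) x x) = α x := by
  ext v
  have h := formInChart_mfderiv_chart α (mem_extChartAt_source (I := 𝓘(ℝ, E)) x) v
  rwa [mfderiv_chart_self] at h

theorem hasFDerivAt_comp_chart_symm {W : Type*} [NormedAddCommGroup W] [NormedSpace ℝ W]
    {f : M → W} {x : M} {e : E} (he : e ∈ (extChartAt 𝓘(ℝ, E) x).target)
    (hf : MDifferentiableAt 𝓘(ℝ, E) 𝓘(ℝ, W) f ((extChartAt 𝓘(ℝ, E) x).symm e)) :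
    HasFDerivAt (fun e => f ((extChartAt 𝓘(ℝ, E) x).symm e))
      ((mvfderiv 𝓘(ℝ, E) f ((extChartAt 𝓘(ℝ, E) x).symm e)).comp
        (mfderiv 𝓘(ℝ, E) 𝓘(ℝ, E) (extChartAt 𝓘(ℝ, E) x).symm e) : E →L[ℝ] W) e :=
  (hf.hasMFDerivAt.comp e (mdifferentiableAt_chart_symm he).hasMFDerivAt).hasFDerivAt

theorem hasFDerivAt_comp_chart_symm_self {W : Type*} [NormedAddCommGroup W] [NormedSpace ℝ W]
    {f : M → W} {x : M} (hf : MDifferentiableAt 𝓘(ℝ, E) 𝓘(ℝ, W) f x) :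
    HasFDerivAt (fun e => f ((extChartAt 𝓘(ℝ, E) x).symm e))
      (mvfderiv 𝓘(ℝ, E) f x : E →L[ℝ] W) (extChartAt 𝓘(ℝ, E) x x) := by
  have h := hasFDerivAt_comp_chart_symm (mem_extChartAt_target (I := 𝓘(ℝ, E)) x) (f := f)
    (by rwa [extChartAt_to_inv])
  refine h.congr_fderiv (Eq.symm ?_)
  ext v
  have key : ∀ z : M, z = x → ∀ w : E, w = v →
      (mvfderiv 𝓘(ℝ, E) f x : E →L[ℝ] W) v = (mvfderiv 𝓘(ℝ, E) f z : E →L[ℝ] W) w := by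
    rintro z rfl w rfl; rfl
  refine key _ (extChartAt_to_inv x) _ ?_
  exact mfderiv_chart_symm_self (E := E) x v

end Charts

/-! ### Brackets of germs of functions and pairings of forms -/

section LocalFunctions

variable {E : Type*} [NormedAddCommGroup E] [NormedSpace ℝ E]
  {M : Type*} [TopologicalSpace M] [ChartedSpace E M]

theorem bracket_congr (π : BivectorField 𝓘(ℝ, E) M) {f f' g g' : M → ℝ} {x : M}
    (hf : f =ᶠ[𝓝 x] f') (hg : g =ᶠ[𝓝 x] g') : bracket π f g x = bracket π f' g' x := by
  unfold bracket
  rw [mvfderiv_congr hf, mvfderiv_congr hg]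

theorem bracket_eventuallyEq (π : BivectorField 𝓘(ℝ, E) M) {f f' g g' : M → ℝ} {x : M}
    (hf : f =ᶠ[𝓝 x] f') (hg : g =ᶠ[𝓝 x] g') : bracket π f g =ᶠ[𝓝 x] bracket π f' g' := by
  filter_upwards [hf.eventuallyEq_nhds, hg.eventuallyEq_nhds] with y hfy hgy
  exact bracket_congr π hfy hgy

theorem IsPoisson.skew {π : BivectorField 𝓘(ℝ, E) M} (hπ : IsPoisson π) {x : M}
    (a b : Cotangent 𝓘(ℝ, E) x) : a (π x b) = - b (π x a) := by
  have h := hπ.alternating x (a + b)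
  have ha := hπ.alternating x a
  have hb := hπ.alternating x b
  have e : (a + b) (π x (a + b)) = a (π x a) + a (π x b) + (b (π x a) + b (π x b)) := by
    rw [map_add]
    change a (π x a + π x b) + b (π x a + π x b) = _
    rw [map_add, map_add]
  linarith

variable [IsManifold 𝓘(ℝ, E) ∞ M] [FiniteDimensional ℝ E] [T2Space M]

theorem exists_cutoff {x : M} {V : Set M} (hV : V ∈ 𝓝 x) :
    ∃ χ : M → ℝ, ContMDiff 𝓘(ℝ, E) 𝓘(ℝ, ℝ) ∞ χ ∧ χ =ᶠ[𝓝 x] 1 ∧ tsupport χ ⊆ V := by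
  obtain ⟨ρ, hρ, -⟩ := (SmoothBumpFunction.nhds_basis_support (I := 𝓘(ℝ, E)) hV).mem_iff.1 hV
  exact ⟨ρ, ρ.contMDiff, ρ.eventuallyEq_one, hρ⟩

/-- `IsPoisson` speaks only of globally smooth functions. Multiplying by a bump function carries its
axioms over to germs. -/
theorem exists_contMDiff_eventuallyEq {f : M → ℝ} {x : M}
    (hf : ∀ᶠ y in 𝓝 x, ContMDiffAt 𝓘(ℝ, E) 𝓘(ℝ, ℝ) ∞ f y) :
    ∃ g : M → ℝ, ContMDiff 𝓘(ℝ, E) 𝓘(ℝ, ℝ) ∞ g ∧ g =ᶠ[𝓝 x] f := by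
  obtain ⟨χ, hχ, h1, hs⟩ := exists_cutoff (E := E) hf
  refine ⟨fun y => χ y • f y, contMDiff_of_tsupport fun y hy => ?_, ?_⟩
  · exact hχ.contMDiffAt.smul (hs (tsupport_smul_subset_left _ _ hy))
  · filter_upwards [h1] with y hy
    simp [hy]

theorem IsPoisson.contMDiffAt_bracket {π : BivectorField 𝓘(ℝ, E) M} (hπ : IsPoisson π)
    {f g : M → ℝ} {x : M}
    (hf : ∀ᶠ y in 𝓝 x, ContMDiffAt 𝓘(ℝ, E) 𝓘(ℝ, ℝ) ∞ f y)
    (hg : ∀ᶠ y in 𝓝 x, ContMDiffAt 𝓘(ℝ, E) 𝓘(ℝ, ℝ) ∞ g y) :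
    ContMDiffAt 𝓘(ℝ, E) 𝓘(ℝ, ℝ) ∞ (bracket π f g) x := by
  obtain ⟨f', hf', ef⟩ := exists_contMDiff_eventuallyEq hf
  obtain ⟨g', hg', eg⟩ := exists_contMDiff_eventuallyEq hg
  exact (hπ.smooth f' g' hf' hg').contMDiffAt.congr_of_eventuallyEq
    (bracket_eventuallyEq π ef.symm eg.symm)

theorem IsPoisson.jacobi_of_eventually {π : BivectorField 𝓘(ℝ, E) M} (hπ : IsPoisson π)
    {f g h : M → ℝ} {x : M}
    (hf : ∀ᶠ y in 𝓝 x, ContMDiffAt 𝓘(ℝ, E) 𝓘(ℝ, ℝ) ∞ f y)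
    (hg : ∀ᶠ y in 𝓝 x, ContMDiffAt 𝓘(ℝ, E) 𝓘(ℝ, ℝ) ∞ g y)
    (hh : ∀ᶠ y in 𝓝 x, ContMDiffAt 𝓘(ℝ, E) 𝓘(ℝ, ℝ) ∞ h y) :
    bracket π f (bracket π g h) x + bracket π g (bracket π h f) x
        + bracket π h (bracket π f g) x = 0 := by
  obtain ⟨f', hf', ef⟩ := exists_contMDiff_eventuallyEq hf
  obtain ⟨g', hg', eg⟩ := exists_contMDiff_eventuallyEq hg
  obtain ⟨h', hh', eh⟩ := exists_contMDiff_eventuallyEq hh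
  rw [← hπ.jacobi f' g' h' hf' hg' hh' x,
    bracket_congr π ef.symm (bracket_eventuallyEq π eg.symm eh.symm),
    bracket_congr π eg.symm (bracket_eventuallyEq π eh.symm ef.symm),
    bracket_congr π eh.symm (bracket_eventuallyEq π ef.symm eg.symm)]

/-- A global smooth function which near `x` is a given linear function in the chart at `x`. -/
theorem exists_linear_near (x : M) (l : E →L[ℝ] ℝ) :
    ∃ f : M → ℝ, ContMDiff 𝓘(ℝ, E) 𝓘(ℝ, ℝ) ∞ f ∧ ∀ᶠ y in 𝓝 x, ∀ v : E,
      mvfderiv 𝓘(ℝ, E) f y v = l (mfderiv 𝓘(ℝ, E) 𝓘(ℝ, E) (extChartAt 𝓘(ℝ, E) x) y v) := by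
  obtain ⟨f, hf, ef⟩ := exists_contMDiff_eventuallyEq (E := E) (x := x)
    (f := fun y => l (extChartAt 𝓘(ℝ, E) x y)) (by
      filter_upwards [eventually_mem_source (E := E) x] with y hy
      exact l.contMDiff.contMDiffAt.comp y (contMDiffAt_chart hy))
  refine ⟨f, hf, ?_⟩
  filter_upwards [ef.eventuallyEq_nhds, eventually_mem_source (E := E) x] with y hy hys v
  rw [mvfderiv_congr hy]
  have := mfderiv_comp y (l.mdifferentiableAt (x := extChartAt 𝓘(ℝ, E) x y))
    (mdifferentiableAt_chart hys)
  refine (congrArg (fun T : E →L[ℝ] ℝ => T v) this).trans ?_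
  exact congrArg (fun T : E →L[ℝ] ℝ => T
    (mfderiv 𝓘(ℝ, E) 𝓘(ℝ, E) (extChartAt 𝓘(ℝ, E) x) y v)) l.mfderiv_eq

/-- Every covector at `x` is the differential of a global smooth function. -/
theorem exists_mvfderiv_eq (x : M) (a : Cotangent 𝓘(ℝ, E) x) :
    ∃ f : M → ℝ, ContMDiff 𝓘(ℝ, E) 𝓘(ℝ, ℝ) ∞ f ∧ mvfderiv 𝓘(ℝ, E) f x = a := by
  obtain ⟨f, hf, h⟩ := exists_linear_near x (show E →L[ℝ] ℝ from a)
  refine ⟨f, hf, ?_⟩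
  ext v
  exact (h.self_of_nhds v).trans (congrArg (a : E → ℝ) (mfderiv_chart_self (E := E) x v))

/-- Regularity of `π` is known only through brackets of functions. Expanding the forms in coordinate
differentials, with coefficients α_i and β_j, turns π(α, β) into the sum of the β_j α_i {f_i, f_j}.
-/
theorem IsPoisson.mdifferentiableAt_pairing {π : BivectorField 𝓘(ℝ, E) M} (hπ : IsPoisson π)
    {α β : CovectorField 𝓘(ℝ, E) M} {x : M}
    (hα : DifferentiableAt ℝ (formInChart α x) (extChartAt 𝓘(ℝ, E) x x))
    (hβ : DifferentiableAt ℝ (formInChart β x) (extChartAt 𝓘(ℝ, E) x x)) :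
    MDifferentiableAt 𝓘(ℝ, E) 𝓘(ℝ, ℝ) (fun y => β y (π y (α y))) x := by
  let b := Module.finBasis ℝ E
  choose f hf hdf using fun i => exists_linear_near x (b.coord i).toContinuousLinearMap
  have expand : ∀ γ : CovectorField 𝓘(ℝ, E) M, ∀ᶠ y in 𝓝 x, γ y =
      ∑ i, formInChart γ x (extChartAt 𝓘(ℝ, E) x y) (b i) • mvfderiv 𝓘(ℝ, E) (f i) y := by
    intro γ
    filter_upwards [eventually_all.2 hdf, eventually_mem_source (E := E) x] with y hy hys
    ext v
    rw [← formInChart_mfderiv_chart γ hys v]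
    refine (congrArg (formInChart γ x (extChartAt 𝓘(ℝ, E) x y))
      (b.sum_repr (mfderiv 𝓘(ℝ, E) 𝓘(ℝ, E) (extChartAt 𝓘(ℝ, E) x) y v : E)).symm).trans ?_
    rw [map_sum]
    refine Eq.trans ?_ (sum_apply _ _ _).symm
    refine Finset.sum_congr rfl fun i _ => ?_
    rw [map_smul]
    change _ = _ * mvfderiv 𝓘(ℝ, E) (f i) y v
    rw [hy i v, smul_eq_mul, mul_comm]
    rfl
  have key : (fun y => β y (π y (α y))) =ᶠ[𝓝 x] fun y =>
      ∑ j, ∑ i, formInChart β x (extChartAt 𝓘(ℝ, E) x y) (b j) *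
        (formInChart α x (extChartAt 𝓘(ℝ, E) x y) (b i) * bracket π (f i) (f j) y) := by
    filter_upwards [expand α, expand β] with y hα hβ
    rw [hα, hβ, map_sum]
    refine (sum_apply _ _ _).trans ?_
    refine Finset.sum_congr rfl fun j _ => ?_
    rw [map_sum]
    refine Finset.sum_congr rfl fun i _ => ?_
    rw [map_smul, map_smul]
    simp only [smul_eq_mul]
    exact mul_left_comm _ _ _
  refine MDifferentiableAt.congr_of_eventuallyEq ?_ key
  have coef : ∀ γ : CovectorField 𝓘(ℝ, E) M,
      DifferentiableAt ℝ (formInChart γ x) (extChartAt 𝓘(ℝ, E) x x) → ∀ i,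
      MDifferentiableAt 𝓘(ℝ, E) 𝓘(ℝ, ℝ)
        (fun y => formInChart γ x (extChartAt 𝓘(ℝ, E) x y) (b i)) x := fun γ hγ i =>
    ((hγ.clm_apply (differentiableAt_const (b i))).mdifferentiableAt).comp x
      (mdifferentiableAt_chart (mem_extChartAt_source x))
  have br : ∀ i j, MDifferentiableAt 𝓘(ℝ, E) 𝓘(ℝ, ℝ) (bracket π (f i) (f j)) x := fun i j =>
    (hπ.smooth _ _ (hf i) (hf j)).contMDiffAt.mdifferentiableAt (by simp)
  have hs : ∀ φ : Fin (Module.finrank ℝ E) → M → ℝ,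
      (∀ i, MDifferentiableAt 𝓘(ℝ, E) 𝓘(ℝ, ℝ) (φ i) x) →
      MDifferentiableAt 𝓘(ℝ, E) 𝓘(ℝ, ℝ) (fun y => ∑ i, φ i y) x := fun φ h => by
    have := MDifferentiableAt.sum (t := Finset.univ) fun i _ => h i
    rwa [show ∑ i, φ i = fun y => ∑ i, φ i y from funext fun y => Finset.sum_apply y _ _] at this
  exact hs _ fun j => hs _ fun i => (coef β hβ j).mul ((coef α hα i).mul (br i j))

end LocalFunctions

/-! ### Smooth one-forms and the exterior derivative in charts -/

section ChartForms

variable {E : Type*} [NormedAddCommGroup E] [NormedSpace ℝ E]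
  {M : Type*} [TopologicalSpace M] [ChartedSpace E M]

theorem extD_apply (α : CovectorField 𝓘(ℝ, E) M) (x : M) (u v : E) :
    (extD α x u : E →L[ℝ] ℝ) v =
      fderiv ℝ (formInChart α x) (extChartAt 𝓘(ℝ, E) x x) u v -
        fderiv ℝ (formInChart α x) (extChartAt 𝓘(ℝ, E) x x) v u := rfl

theorem extD_swap (α : CovectorField 𝓘(ℝ, E) M) (x : M) (u v : TangentSpace 𝓘(ℝ, E) x) :
    extD α x u v = - extD α x v u := by
  have h1 := extD_apply α x u v
  have h2 := extD_apply α x v u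
  have : (extD α x u : E →L[ℝ] ℝ) v = - (extD α x v : E →L[ℝ] ℝ) u := by
    rw [h1, h2]; ring
  exact this

variable [IsManifold 𝓘(ℝ, E) ∞ M]

/-- Bundle smoothness is defined through trivializations, while `extD` uses `formInChart`; this
identifies the two coordinate expressions. -/
theorem inCoordinates_cotangent (α : CovectorField 𝓘(ℝ, E) M) {x y : M}
    (hy : y ∈ (extChartAt 𝓘(ℝ, E) x).source) :
    ContinuousLinearMap.inCoordinates E (TangentSpace 𝓘(ℝ, E) : M → Type _) ℝ
      (fun _ : M => ℝ) x y x y (α y) = formInChart α x (extChartAt 𝓘(ℝ, E) x y) := by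
  have : IsManifold 𝓘(ℝ, E) 1 M := inferInstance
  have hs := TangentBundle.symmL_trivializationAt (I := 𝓘(ℝ, E)) (x₀ := x) (x := y)
    (by rwa [extChartAt_source] at hy)
  simp only [modelWithCornersSelf_coe, range_id, mfderivWithin_univ] at hs
  ext v
  have h1 : α y ((trivializationAt E (TangentSpace 𝓘(ℝ, E) : M → Type _) x).symmL ℝ y v) =
      formInChart α x (extChartAt 𝓘(ℝ, E) x y) v := by
    rw [hs]
    exact (covectorField_congr α ((extChartAt 𝓘(ℝ, E) x).left_inv hy) _).symm
  rw [← h1]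
  exact congrArg (fun T : ℝ →L[ℝ] ℝ =>
    T (α y ((trivializationAt E (TangentSpace 𝓘(ℝ, E) : M → Type _) x).symmL ℝ y v)))
    (Bundle.Trivial.continuousLinearMapAt_trivialization ℝ M ℝ y)

theorem isSmoothForm_iff {α : CovectorField 𝓘(ℝ, E) M} :
    IsSmoothForm α ↔ ∀ x, ContMDiffAt 𝓘(ℝ, E) 𝓘(ℝ, E →L[ℝ] ℝ) ∞
      (fun y => formInChart α x (extChartAt 𝓘(ℝ, E) x y)) x := by
  refine forall_congr' fun x => ?_
  rw [contMDiffAt_hom_bundle]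
  refine (and_iff_right contMDiffAt_id).trans (Filter.EventuallyEq.contMDiffAt_iff ?_)
  filter_upwards [eventually_mem_source (E := E) x] with y hy
  exact inCoordinates_cotangent α hy

theorem contDiffAt_formInChart {α : CovectorField 𝓘(ℝ, E) M} (hα : IsSmoothForm α) (x : M) :
    ContDiffAt ℝ ∞ (formInChart α x) (extChartAt 𝓘(ℝ, E) x x) := by
  have h := isSmoothForm_iff.1 hα x
  rw [← contMDiffAt_iff_contDiffAt]
  have h1 := h.comp_of_eq (contMDiffAt_chart_symm (mem_extChartAt_target (I := 𝓘(ℝ, E)) x))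
    (extChartAt_to_inv x)
  refine h1.congr_of_eventuallyEq ?_
  filter_upwards [eventually_mem_target (E := E) x] with e he
  simp only [Function.comp_apply]
  rw [(extChartAt 𝓘(ℝ, E) x).right_inv he]

theorem formInChart_mvfderiv_eventuallyEq {f : M → ℝ} {x : M}
    (hf : ∀ᶠ y in 𝓝 x, ContMDiffAt 𝓘(ℝ, E) 𝓘(ℝ, ℝ) ∞ f y) :
    formInChart (mvfderiv 𝓘(ℝ, E) f) x =ᶠ[𝓝 (extChartAt 𝓘(ℝ, E) x x)]
      fderiv ℝ (fun e => f ((extChartAt 𝓘(ℝ, E) x).symm e)) := by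
  filter_upwards [eventually_mem_target (E := E) x, eventually_chart_symm (E := E) hf] with e he hfe
  exact (hasFDerivAt_comp_chart_symm he (hfe.mdifferentiableAt (by simp))).fderiv.symm

theorem contDiffAt_comp_chart_symm {f : M → ℝ} {x : M}
    (hf : ContMDiffAt 𝓘(ℝ, E) 𝓘(ℝ, ℝ) ∞ f x) :
    ContDiffAt ℝ ∞ (fun e => f ((extChartAt 𝓘(ℝ, E) x).symm e)) (extChartAt 𝓘(ℝ, E) x x) := by
  rw [← contMDiffAt_iff_contDiffAt]
  exact hf.comp_of_eq (contMDiffAt_chart_symm (mem_extChartAt_target (I := 𝓘(ℝ, E)) x))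
    (extChartAt_to_inv x)

theorem differentiableAt_formInChart_mvfderiv {f : M → ℝ} {x : M}
    (hf : ∀ᶠ y in 𝓝 x, ContMDiffAt 𝓘(ℝ, E) 𝓘(ℝ, ℝ) ∞ f y) :
    DifferentiableAt ℝ (formInChart (mvfderiv 𝓘(ℝ, E) f) x) (extChartAt 𝓘(ℝ, E) x x) :=
  (((contDiffAt_comp_chart_symm hf.self_of_nhds).fderiv_right (m := 1)
    (by norm_cast)).differentiableAt (by simp)).congr_of_eventuallyEq
    (formInChart_mvfderiv_eventuallyEq hf)

/-- In the chart df is the ordinary derivative of f, so d(df) = 0 is the symmetry of its second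
derivative. -/
theorem extD_mvfderiv {f : M → ℝ} {x : M}
    (hf : ∀ᶠ y in 𝓝 x, ContMDiffAt 𝓘(ℝ, E) 𝓘(ℝ, ℝ) ∞ f y) (u v : TangentSpace 𝓘(ℝ, E) x) :
    extD (mvfderiv 𝓘(ℝ, E) f) x u v = 0 := by
  refine (extD_apply (E := E) _ x u v).trans ?_
  rw [(formInChart_mvfderiv_eventuallyEq hf).fderiv_eq, sub_eq_zero]
  exact (contDiffAt_comp_chart_symm hf.self_of_nhds).isSymmSndFDerivAt
    (by simp only [minSmoothness_of_isRCLikeNormedField]; norm_cast) u v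

theorem isSmoothForm_mvfderiv {f : M → ℝ} (hf : ContMDiff 𝓘(ℝ, E) 𝓘(ℝ, ℝ) ∞ f) :
    IsSmoothForm (mvfderiv 𝓘(ℝ, E) f) := by
  refine isSmoothForm_iff.2 fun x => ?_
  have hd : ContDiffAt ℝ ∞ (fderiv ℝ fun e => f ((extChartAt 𝓘(ℝ, E) x).symm e))
      (extChartAt 𝓘(ℝ, E) x x) :=
    (contDiffAt_comp_chart_symm hf.contMDiffAt).fderiv_right (by norm_cast)
  have h := formInChart_mvfderiv_eventuallyEq (x := x) (Eventually.of_forall hf)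
  exact ((hd.congr_of_eventuallyEq h).contMDiffAt).comp x
    (contMDiffAt_chart (mem_extChartAt_source x))

end ChartForms

/-! ### Regularity of left-invariant forms -/

section LeftInvariant

variable {E : Type*} [NormedAddCommGroup E] [NormedSpace ℝ E]
  {G : Type*} [TopologicalSpace G] [ChartedSpace E G] [Group G] [LieGroup 𝓘(ℝ, E) ∞ G]

/-- In the chart ψ at 1 the form at e is ξ composed with the second partial derivative at (e, e) of
t(e, e') = ψ(ψ⁻¹(e)⁻¹ ψ⁻¹(e')), and t is smooth near (ψ 1, ψ 1). -/
theorem differentiableAt_formInChart_leftInvariantForm (ξ : Cotangent 𝓘(ℝ, E) (1 : G)) :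
    DifferentiableAt ℝ (formInChart (leftInvariantForm ξ) (1 : G))
      (extChartAt 𝓘(ℝ, E) (1 : G) 1) := by
  set ψ := extChartAt 𝓘(ℝ, E) (1 : G) with hψ
  let t : E × E → E := fun p => ψ ((ψ.symm p.1)⁻¹ * ψ.symm p.2)
  have ht : ContDiffAt ℝ ∞ t (ψ 1, ψ 1) := by
    rw [← contMDiffAt_iff_contDiffAt]
    have h1 : ContMDiffAt 𝓘(ℝ, E × E) 𝓘(ℝ, E) ∞ (fun p : E × E => ψ.symm p.1) (ψ 1, ψ 1) :=
      (contMDiffAt_chart_symm (mem_extChartAt_target (I := 𝓘(ℝ, E)) (1 : G))).comp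
        (ψ 1, ψ 1) contDiffAt_fst.contMDiffAt
    have h2 : ContMDiffAt 𝓘(ℝ, E × E) 𝓘(ℝ, E) ∞ (fun p : E × E => ψ.symm p.2) (ψ 1, ψ 1) :=
      (contMDiffAt_chart_symm (mem_extChartAt_target (I := 𝓘(ℝ, E)) (1 : G))).comp
        (ψ 1, ψ 1) contDiffAt_snd.contMDiffAt
    refine (contMDiffAt_chart (mem_extChartAt_source (I := 𝓘(ℝ, E)) (1 : G))).comp_of_eq
      (h1.inv.mul h2) ?_
    simp
  have key : formInChart (leftInvariantForm ξ) (1 : G) =ᶠ[𝓝 (ψ 1)] fun e =>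
      (show E →L[ℝ] ℝ from ξ).comp
        ((fderiv ℝ t (e, e)).comp (ContinuousLinearMap.inr ℝ E E)) := by
    have hd : ∀ᶠ e in 𝓝 (ψ 1), DifferentiableAt ℝ t (e, e) := by
      have hc : Tendsto (fun e : E => (e, e)) (𝓝 (ψ 1)) (𝓝 (ψ 1, ψ 1)) :=
        Continuous.tendsto (by fun_prop) _
      refine hc.eventually ?_
      filter_upwards [(ht.of_le (m := 1) (by norm_cast)).eventually (by simp)] with p hp
      exact hp.differentiableAt (by simp)
    filter_upwards [hd, eventually_mem_target (E := E) (1 : G)] with e hde he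
    have h1 : HasFDerivAt (fun e' => t (e, e'))
        ((fderiv ℝ t (e, e)).comp (ContinuousLinearMap.inr ℝ E E)) e :=
      hde.hasFDerivAt.comp e (hasFDerivAt_prodMk_right e e)
    have h2 : MDifferentiableAt 𝓘(ℝ, E) 𝓘(ℝ, E) (fun k : G => (ψ.symm e)⁻¹ * k) (ψ.symm e) :=
      (contMDiff_mul_left (I := 𝓘(ℝ, E)) (n := ∞) (a := (ψ.symm e)⁻¹)).contMDiffAt.mdifferentiableAt
        (by simp)
    have h3 := h2.hasMFDerivAt.comp e (mdifferentiableAt_chart_symm he).hasMFDerivAt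
    have hone : (ψ.symm e)⁻¹ * ψ.symm e = 1 := inv_mul_cancel _
    have h4 := (mdifferentiableAt_chart (x := (1 : G)) (y := (ψ.symm e)⁻¹ * ψ.symm e)
      (by rw [hone]; exact mem_extChartAt_source _)).hasMFDerivAt.comp e h3
    have h5 := h1.unique h4.hasFDerivAt
    rw [h5]
    ext v
    have key : ∀ z : G, z = 1 → ∀ w : E,
        (mfderiv 𝓘(ℝ, E) 𝓘(ℝ, E) (extChartAt 𝓘(ℝ, E) (1 : G)) z w : E) = w := by
      rintro z rfl w
      exact mfderiv_chart_self 1 w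
    exact congrArg (ξ : E → ℝ) (key _ hone _).symm
  refine DifferentiableAt.congr_of_eventuallyEq ?_ key
  have hd := (ht.fderiv_right (m := 1) (by norm_cast)).differentiableAt (by simp)
  have hd2 : DifferentiableAt ℝ (fun e => fderiv ℝ t (e, e)) (ψ 1) :=
    hd.comp (ψ 1) (f := fun e : E => (e, e)) (by fun_prop)
  exact (differentiableAt_const _).clm_comp (hd2.clm_comp (differentiableAt_const _))

end LeftInvariant

/-! ### Poisson maps out of a product -/

section Pairing

variable {E : Type*} [NormedAddCommGroup E] [NormedSpace ℝ E]
  {M : Type*} [TopologicalSpace M] [ChartedSpace E M]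
  {E' : Type*} [NormedAddCommGroup E'] [NormedSpace ℝ E']
  {N : Type*} [TopologicalSpace N] [ChartedSpace E' N]
  {E'' : Type*} [NormedAddCommGroup E''] [NormedSpace ℝ E'']
  {P : Type*} [TopologicalSpace P] [ChartedSpace E'' P]

theorem bivectorField_congr (π : BivectorField 𝓘(ℝ, E) M) {y z : M} (h : z = y) (a : E →L[ℝ] ℝ) :
    (π z a : E) = π y a := by
  subst h; rfl

/-- A map out of a product is Poisson at `(x, y)` if and only if the target bivector is the sum of
the images of the bivectors of the factors under the partial maps. -/
theorem PoissonRelatedAt.apply_prod {πM : BivectorField 𝓘(ℝ, E) M} {πN : BivectorField 𝓘(ℝ, E') N}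
    {πP : BivectorField 𝓘(ℝ, E'') P} {φ : M × N → P} {x : M} {y : N}
    (h : PoissonRelatedAt (prodBivector πM πN) πP φ (x, y))
    (hφ : MDifferentiableAt (𝓘(ℝ, E).prod 𝓘(ℝ, E')) 𝓘(ℝ, E'') φ (x, y))
    (a b : E'' →L[ℝ] ℝ) :
    b (πP (φ (x, y)) a) =
      b (mfderiv 𝓘(ℝ, E) 𝓘(ℝ, E'') (fun z => φ (z, y)) x
        (πM x (a.comp (mfderiv 𝓘(ℝ, E) 𝓘(ℝ, E'') (fun z => φ (z, y)) x : E →L[ℝ] E'')))) +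
      b (mfderiv 𝓘(ℝ, E') 𝓘(ℝ, E'') (fun z => φ (x, z)) y
        (πN y (a.comp (mfderiv 𝓘(ℝ, E') 𝓘(ℝ, E'') (fun z => φ (x, z)) y : E' →L[ℝ] E'')))) := by
  set D1 : E →L[ℝ] E'' := mfderiv 𝓘(ℝ, E) 𝓘(ℝ, E'') (fun z => φ (z, y)) x with hD1
  set D2 : E' →L[ℝ] E'' := mfderiv 𝓘(ℝ, E') 𝓘(ℝ, E'') (fun z => φ (x, z)) y with hD2
  have hD : ∀ v : E × E', (mfderiv (𝓘(ℝ, E).prod 𝓘(ℝ, E')) 𝓘(ℝ, E'') φ (x, y) v : E'') =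
      D1 v.1 + D2 v.2 := fun v => mfderiv_prod_eq_add_apply hφ
  have h1 : cotangentFst (I := 𝓘(ℝ, E)) (J := 𝓘(ℝ, E')) (x, y) (ContinuousLinearMap.comp (a : E'' →L[ℝ] ℝ)
      (mfderiv (𝓘(ℝ, E).prod 𝓘(ℝ, E')) 𝓘(ℝ, E'') φ (x, y) : E × E' →L[ℝ] E'')) = a.comp D1 := by
    ext v
    refine (congrArg a (hD (v, 0))).trans ?_
    change a (D1 v + D2 0) = a (D1 v)
    rw [map_zero, add_zero]
  have h2 : cotangentSnd (I := 𝓘(ℝ, E)) (J := 𝓘(ℝ, E')) (x, y) (ContinuousLinearMap.comp (a : E'' →L[ℝ] ℝ)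
      (mfderiv (𝓘(ℝ, E).prod 𝓘(ℝ, E')) 𝓘(ℝ, E'') φ (x, y) : E × E' →L[ℝ] E'')) = a.comp D2 := by
    ext v
    refine (congrArg a (hD (0, v))).trans ?_
    change a (D1 0 + D2 v) = a (D2 v)
    rw [map_zero, zero_add]
  refine (congrArg b (h a)).trans ((congrArg b (hD _)).trans ?_)
  refine (map_add b _ _).trans ?_
  congr 1
  · exact congrArg (fun c : E →L[ℝ] ℝ => b (D1 (πM x c))) h1
  · exact congrArg (fun c : E' →L[ℝ] ℝ => b (D2 (πN y c))) h2

end Pairing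

/-! ### Linearization of the Poisson Lie structure at the identity -/

section Dual

variable {E : Type*} [NormedAddCommGroup E] [NormedSpace ℝ E]
  {G : Type*} [TopologicalSpace G] [ChartedSpace E G] [Group G]
  {πG : BivectorField 𝓘(ℝ, E) G}

/-- The bivector of a Poisson Lie group vanishes at the identity. -/
theorem IsPoissonLie.apply_one (hG : IsPoissonLie πG)
    (a b : E →L[ℝ] ℝ) : b (πG 1 a) = 0 := by
  have h := (hG.mul.related (1, 1)).apply_prod
    (hG.mul.smooth.contMDiffAt.mdifferentiableAt (by simp)) a b
  have hl : (mfderiv 𝓘(ℝ, E) 𝓘(ℝ, E) (fun z : G => z * 1) 1 : E →L[ℝ] E) =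
      ContinuousLinearMap.id ℝ E := by
    have h : (fun z : G => z * 1) = id := funext mul_one
    rw [h]; exact mfderiv_id
  have hr : (mfderiv 𝓘(ℝ, E) 𝓘(ℝ, E) (fun z : G => 1 * z) 1 : E →L[ℝ] E) =
      ContinuousLinearMap.id ℝ E := by
    have h : (fun z : G => 1 * z) = id := funext one_mul
    rw [h]; exact mfderiv_id
  have e := congrArg b (bivectorField_congr πG (mul_one (1 : G)) a)
  have key : ∀ T S : E →L[ℝ] E, T = ContinuousLinearMap.id ℝ E → S = ContinuousLinearMap.id ℝ E →
      b (πG (1 * 1) a) = b (T (πG 1 (a.comp T))) + b (S (πG 1 (a.comp S))) →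
      b (πG (1 * 1) a) = b (πG 1 a) + b (πG 1 a) := by
    rintro T S rfl rfl h; exact h
  -- Both partial maps of the multiplication at (1, 1) are the identity, so the Poisson property
  -- says that the bivector at 1 is twice itself.
  have h' := key _ _ hl hr h
  linarith [h'.symm.trans e]

/-- The bivector of `G` in the left trivialization of the cotangent bundle. -/
def leftPairing (πG : BivectorField 𝓘(ℝ, E) G) (g : G) :
    (E →L[ℝ] ℝ) →ₗ[ℝ] (E →L[ℝ] ℝ) →ₗ[ℝ] ℝ :=
  LinearMap.mk₂ ℝ (fun ξ η => leftInvariantForm (E := E) η g (πG g (leftInvariantForm (E := E) ξ g)))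
    (fun ξ ξ' η => (congrArg (leftInvariantForm (E := E) η g)
      (map_add (πG g) (leftInvariantForm (E := E) ξ g) (leftInvariantForm (E := E) ξ' g))).trans
      (map_add _ _ _))
    (fun c ξ η => (congrArg (leftInvariantForm (E := E) η g)
      (map_smul (πG g) c (leftInvariantForm (E := E) ξ g))).trans (map_smul _ _ _))
    (fun _ _ _ => rfl) (fun _ _ _ => rfl)

theorem IsPoissonLie.leftPairing_one (hG : IsPoissonLie πG) (ξ η : E →L[ℝ] ℝ) :
    leftPairing πG 1 ξ η = 0 :=
  hG.apply_one (leftInvariantForm (E := E) ξ (1 : G)) (leftInvariantForm (E := E) η (1 : G))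

variable [LieGroup 𝓘(ℝ, E) ∞ G] [FiniteDimensional ℝ E] [T2Space G]

/-- `dualBracket` is defined by `mvfderiv`, which takes a default value where the function is not
differentiable; differentiability of the pairing makes it a genuine derivative. -/
theorem IsPoissonLie.hasFDerivAt_leftPairing (hG : IsPoissonLie πG) (ξ η : E →L[ℝ] ℝ) :
    HasFDerivAt (fun u => leftPairing πG ((extChartAt 𝓘(ℝ, E) (1 : G)).symm u) ξ η)
      (dualBracket πG ξ η : E →L[ℝ] ℝ) (extChartAt 𝓘(ℝ, E) (1 : G) 1) :=
  hasFDerivAt_comp_chart_symm_self (hG.isPoisson.mdifferentiableAt_pairing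
    (differentiableAt_formInChart_leftInvariantForm (E := E) ξ)
    (differentiableAt_formInChart_leftInvariantForm (E := E) η))

/-- Only the values of ξ and η at the identity matter: in the product rule their derivatives are
multiplied by the bivector at 1, which is zero. -/
theorem IsPoissonLie.hasFDerivAt_leftPairing_comp (hG : IsPoissonLie πG)
    {ξ η : E → E →L[ℝ] ℝ}
    (hξ : DifferentiableAt ℝ ξ (extChartAt 𝓘(ℝ, E) (1 : G) 1))
    (hη : DifferentiableAt ℝ η (extChartAt 𝓘(ℝ, E) (1 : G) 1)) :
    HasFDerivAt (fun u => leftPairing πG ((extChartAt 𝓘(ℝ, E) (1 : G)).symm u) (ξ u) (η u))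
      (dualBracket πG (ξ (extChartAt 𝓘(ℝ, E) (1 : G) 1)) (η (extChartAt 𝓘(ℝ, E) (1 : G) 1)) :
        E →L[ℝ] ℝ) (extChartAt 𝓘(ℝ, E) (1 : G) 1) := by
  set u₀ := extChartAt 𝓘(ℝ, E) (1 : G) 1 with hu₀
  let b := Module.finBasis ℝ (E →L[ℝ] ℝ)
  let D : (E →L[ℝ] ℝ) → (E →L[ℝ] ℝ) → E →L[ℝ] ℝ := fun ξ η => dualBracket πG ξ η
  have claim : ∀ ξ η : E → E →L[ℝ] ℝ, DifferentiableAt ℝ ξ u₀ → DifferentiableAt ℝ η u₀ →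
      HasFDerivAt (fun u => leftPairing πG ((extChartAt 𝓘(ℝ, E) (1 : G)).symm u) (ξ u) (η u))
        (∑ j, ∑ i, (b.repr (η u₀) j * b.repr (ξ u₀) i) •
          D (b i) (b j)) u₀ := by
    intro ξ η hξ hη
    have hexp : (fun u => leftPairing πG ((extChartAt 𝓘(ℝ, E) (1 : G)).symm u) (ξ u) (η u)) =
        fun u => ∑ j, ∑ i, (b.repr (η u) j * b.repr (ξ u) i) *
          leftPairing πG ((extChartAt 𝓘(ℝ, E) (1 : G)).symm u) (b i) (b j) := by
      funext u
      conv_lhs => rw [← b.sum_repr (ξ u), ← b.sum_repr (η u)]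
      simp only [map_sum, LinearMap.sum_apply, map_smul, LinearMap.smul_apply, smul_eq_mul,
        mul_assoc, Finset.mul_sum]
    rw [hexp]
    have hc : ∀ ζ : E → E →L[ℝ] ℝ, DifferentiableAt ℝ ζ u₀ → ∀ i,
        DifferentiableAt ℝ (fun u => b.repr (ζ u) i) u₀ := fun ζ hζ i =>
      (b.coord i).toContinuousLinearMap.differentiableAt.comp u₀ hζ
    refine HasFDerivAt.fun_sum fun j _ => HasFDerivAt.fun_sum fun i _ => ?_
    have h := (((hc η hη j).mul (hc ξ hξ i)).hasFDerivAt).mul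
      (hG.hasFDerivAt_leftPairing (b i) (b j))
    refine h.congr_fderiv ?_
    rw [extChartAt_to_inv, hG.leftPairing_one, zero_smul, add_zero]
    rfl
  refine (claim ξ η hξ hη).congr_fderiv ?_
  -- Applying the claim to constant families identifies the basis expansion with `dualBracket`, so
  -- bilinearity of the latter need not be proved separately.
  exact (claim (fun _ => ξ u₀) (fun _ => η u₀) (differentiableAt_const _)
    (differentiableAt_const _)).unique (hG.hasFDerivAt_leftPairing (ξ u₀) (η u₀))

end Dual

/-! ### Cartan's formula for families of maps of vector spaces -/

section Flat

variable {E : Type*} [NormedAddCommGroup E] [NormedSpace ℝ E]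
  {F : Type*} [NormedAddCommGroup F] [NormedSpace ℝ F]

/-- The pullback of a one-form `A` along the maps `s (u, ·)` at a fixed point, as a function of
the parameter `u`. -/
def pullbackAlong (s : E × F → F) (A : F → F →L[ℝ] ℝ) (e : F) (u : E) : F →L[ℝ] ℝ :=
  (A (s (u, e))).comp ((fderiv ℝ s (u, e)).comp (ContinuousLinearMap.inr ℝ E F))

variable {s : E × F → F} {u : E} {e : F} {A : F → F →L[ℝ] ℝ}

theorem differentiableAt_fderiv_of_contDiffAt (hs : ContDiffAt ℝ ∞ s (u, e)) :
    DifferentiableAt ℝ (fderiv ℝ s) (u, e) :=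
  (hs.fderiv_right (m := 1) (by norm_cast)).differentiableAt (by simp)

theorem differentiableAt_pullbackAlong (hs : ContDiffAt ℝ ∞ s (u, e)) (hse : s (u, e) = e)
    (hA : DifferentiableAt ℝ A e) : DifferentiableAt ℝ (pullbackAlong s A e) u := by
  have hl : DifferentiableAt ℝ (fun u' : E => (u', e)) u := by fun_prop
  have h1 : DifferentiableAt ℝ (fun u' => A (s (u', e))) u :=
    DifferentiableAt.comp u (g := A) (f := fun u' => s (u', e)) (by rwa [hse])
      (DifferentiableAt.comp u (g := s) (hs.differentiableAt (by simp)) hl)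
  have h2 : DifferentiableAt ℝ (fun u' => fderiv ℝ s (u', e)) u :=
    DifferentiableAt.comp u (g := fderiv ℝ s) (differentiableAt_fderiv_of_contDiffAt hs) hl
  exact h1.clm_comp (h2.clm_comp (differentiableAt_const _))

/-- Cartan's formula for a one-form that vanishes on the generator of a family of maps. -/
theorem fderiv_pullbackAlong (hs : ContDiffAt ℝ ∞ s (u, e)) (hse : s (u, e) = e)
    (hid : ∀ v : F, fderiv ℝ s (u, e) (0, v) = v) (hA : DifferentiableAt ℝ A e) (X : E)
    (hX : ∀ᶠ e' in 𝓝 e, A e' (fderiv ℝ s (u, e') (X, 0)) = 0) (v : F) :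
    fderiv ℝ (pullbackAlong s A e) u X v =
      fderiv ℝ A e (fderiv ℝ s (u, e) (X, 0)) v - fderiv ℝ A e v (fderiv ℝ s (u, e) (X, 0)) := by
  have hS := (differentiableAt_fderiv_of_contDiffAt hs).hasFDerivAt
  have hsd := (hs.differentiableAt (by simp)).hasFDerivAt
  have hsymm : IsSymmSndFDerivAt ℝ s (u, e) :=
    hs.isSymmSndFDerivAt (by simp only [minSmoothness_of_isRCLikeNormedField]; norm_cast)
  have hA' : HasFDerivAt A (fderiv ℝ A e) (s (u, e)) := by rw [hse]; exact hA.hasFDerivAt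
  have hl : HasFDerivAt (fun u' : E => (u', e)) (ContinuousLinearMap.inl ℝ E F) u :=
    hasFDerivAt_prodMk_left u e
  have hr : HasFDerivAt (fun e' : F => (u, e')) (ContinuousLinearMap.inr ℝ E F) e :=
    hasFDerivAt_prodMk_right u e
  have hAs : HasFDerivAt (fun u' => A (s (u', e))) _ u :=
    HasFDerivAt.comp (g := A) (f := fun u' => s (u', e)) u hA' (hsd.comp u hl)
  have hSl : HasFDerivAt (fun u' => fderiv ℝ s (u', e)) _ u := hS.comp u hl
  have hSr : HasFDerivAt (fun e' => fderiv ℝ s (u, e')) _ e := hS.comp e hr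
  have h1 := hAs.clm_apply (hSl.clm_apply (hasFDerivAt_const ((0 : E), v) u))
  have h1' := ((differentiableAt_pullbackAlong hs hse hA).hasFDerivAt.clm_apply
    (hasFDerivAt_const v u))
  have e1 := congrArg (fun T : E →L[ℝ] ℝ => T X) (h1'.unique h1)
  have h2 := hA.hasFDerivAt.clm_apply
    (hSr.clm_apply (hasFDerivAt_const (X, (0 : F)) e))
  have h2' : HasFDerivAt (fun e' => A e' (fderiv ℝ s (u, e') (X, 0))) (0 : F →L[ℝ] ℝ) e :=
    (hasFDerivAt_const (0 : ℝ) e).congr_of_eventuallyEq hX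
  have e2 := congrArg (fun T : F →L[ℝ] ℝ => T v) (h2'.unique h2)
  simp [hse, hid] at e1 e2
  -- `e1` differentiates the pullback in the direction `X`, `e2` the vanishing of `A` on the
  -- generator along `v`. Both contain `A` applied to a mixed second derivative of `s`; by symmetry
  -- these terms cancel.
  have e3 := hsymm (X, 0) (0, v)
  rw [e3] at e1
  linarith

end Flat

/-! ### The Poisson property of the action, split into partial maps -/

section Action

variable {E : Type*} [NormedAddCommGroup E] [NormedSpace ℝ E]
  {F : Type*} [NormedAddCommGroup F] [NormedSpace ℝ F]
  {G : Type*} [TopologicalSpace G] [ChartedSpace E G] [Group G]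
  {M : Type*} [TopologicalSpace M] [ChartedSpace F M] [MulAction G M]

/-- The derivative at `x` of the action of `g`. -/
def translationDeriv (F : Type*) [NormedAddCommGroup F] [NormedSpace ℝ F]
    {G : Type*} [Group G] {M : Type*} [TopologicalSpace M] [ChartedSpace F M] [MulAction G M]
    (g : G) (x : M) : F →L[ℝ] F :=
  mfderiv 𝓘(ℝ, F) 𝓘(ℝ, F) (fun y : M => g • y) x

/-- The infinitesimal action as a continuous linear map between the model spaces. -/
def orbitDeriv (E : Type*) [NormedAddCommGroup E] [NormedSpace ℝ E]
    (F : Type*) [NormedAddCommGroup F] [NormedSpace ℝ F]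
    (G : Type*) [TopologicalSpace G] [ChartedSpace E G] [Group G]
    {M : Type*} [TopologicalSpace M] [ChartedSpace F M] [MulAction G M] (x : M) : E →L[ℝ] F :=
  mfderiv 𝓘(ℝ, E) 𝓘(ℝ, F) (fun g : G => g • x) 1

theorem contMDiff_translation (E F : Type*) [NormedAddCommGroup E] [NormedSpace ℝ E]
    [NormedAddCommGroup F] [NormedSpace ℝ F] {G : Type*} [TopologicalSpace G] [ChartedSpace E G]
    [Group G] {M : Type*} [TopologicalSpace M] [ChartedSpace F M] [MulAction G M]
    [ContMDiffSMul 𝓘(ℝ, E) 𝓘(ℝ, F) ∞ G M] (g : G) :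
    ContMDiff 𝓘(ℝ, F) 𝓘(ℝ, F) ∞ (fun y : M => g • y) :=
  (ContMDiffSMul.contMDiff_smul (I := 𝓘(ℝ, E)) (I' := 𝓘(ℝ, F)) (n := ∞) (G := G) (M := M)).comp
    (contMDiff_const.prodMk contMDiff_id)

theorem contMDiff_orbitMap (E F : Type*) [NormedAddCommGroup E] [NormedSpace ℝ E]
    [NormedAddCommGroup F] [NormedSpace ℝ F] {G : Type*} [TopologicalSpace G] [ChartedSpace E G]
    [Group G] {M : Type*} [TopologicalSpace M] [ChartedSpace F M] [MulAction G M]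
    [ContMDiffSMul 𝓘(ℝ, E) 𝓘(ℝ, F) ∞ G M] (x : M) :
    ContMDiff 𝓘(ℝ, E) 𝓘(ℝ, F) ∞ (fun g : G => g • x) :=
  (ContMDiffSMul.contMDiff_smul (I := 𝓘(ℝ, E)) (I' := 𝓘(ℝ, F)) (n := ∞) (G := G) (M := M)).comp
    (contMDiff_id.prodMk contMDiff_const)

variable [ContMDiffSMul 𝓘(ℝ, E) 𝓘(ℝ, F) ∞ G M] [LieGroup 𝓘(ℝ, E) ∞ G]

/-- Differentiate k • x = g • ((g⁻¹ k) • x) at k = g. This moves the orbit map to the identity and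
brings out the left trivialization. -/
theorem mfderiv_orbitMap (g : G) (x : M) :
    (mfderiv 𝓘(ℝ, E) 𝓘(ℝ, F) (fun k : G => k • x) g : E →L[ℝ] F) =
      (translationDeriv F g x).comp ((orbitDeriv E F G x).comp
        (mfderiv 𝓘(ℝ, E) 𝓘(ℝ, E) (fun k : G => g⁻¹ * k) g : E →L[ℝ] E)) := by
  have hfun : (fun k : G => k • x) = fun k => g • ((g⁻¹ * k) • x) := by
    funext k; rw [smul_smul, mul_inv_cancel_left]
  have h1 : MDifferentiableAt 𝓘(ℝ, E) 𝓘(ℝ, E) (fun k : G => g⁻¹ * k) g :=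
    (contMDiff_mul_left (I := 𝓘(ℝ, E)) (n := ∞) (a := g⁻¹)).contMDiffAt.mdifferentiableAt (by simp)
  have key : ∀ (z : G) (y : M), z = 1 → z • x = y → ∀ T : E →L[ℝ] E,
      ((mfderiv 𝓘(ℝ, F) 𝓘(ℝ, F) (fun y : M => g • y) (z • x) : F →L[ℝ] F).comp
      ((mfderiv 𝓘(ℝ, E) 𝓘(ℝ, F) (fun k : G => k • x) z : E →L[ℝ] F).comp T)) =
      (translationDeriv F g y).comp ((orbitDeriv E F G x).comp T) := by
    rintro z y rfl rfl T; rfl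
  have h2 : MDifferentiableAt 𝓘(ℝ, E) 𝓘(ℝ, F) (fun k : G => k • x) (g⁻¹ * g) :=
    (contMDiff_orbitMap E F x).contMDiffAt.mdifferentiableAt (by simp)
  have h3 : MDifferentiableAt 𝓘(ℝ, F) 𝓘(ℝ, F) (fun y : M => g • y) ((g⁻¹ * g) • x) :=
    (contMDiff_translation E F g).contMDiffAt.mdifferentiableAt (by simp)
  have h4 := h3.hasMFDerivAt.comp g (h2.hasMFDerivAt.comp g h1.hasMFDerivAt)
  refine Eq.trans ?_ (key _ x (inv_mul_cancel g) (by simp) _)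
  refine Eq.trans ?_ h4.mfderiv
  have hcongr : ∀ f f' : G → M, f = f' → (mfderiv 𝓘(ℝ, E) 𝓘(ℝ, F) f g : E →L[ℝ] F) =
      mfderiv 𝓘(ℝ, E) 𝓘(ℝ, F) f' g := by
    rintro f _ rfl; rfl
  exact hcongr _ _ hfun

/-- The two summands come from the partial maps y ↦ g • y and k ↦ k • x. By the factorization of the
orbit map, the second is expressed through left-invariant forms, ready to be differentiated at g =
1. -/
theorem IsPoissonAction.apply {πG : BivectorField 𝓘(ℝ, E) G} {π : BivectorField 𝓘(ℝ, F) M}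
    (h : IsPoissonAction πG π) (g : G) (x : M) (a b : F →L[ℝ] ℝ) :
    b (π (g • x) a) =
      (b.comp (translationDeriv F g x)) (π x (a.comp (translationDeriv F g x))) +
        leftPairing πG g ((a.comp (translationDeriv F g x)).comp (orbitDeriv E F G x))
          ((b.comp (translationDeriv F g x)).comp (orbitDeriv E F G x)) := by
  have h1 := (h.related (g, x)).apply_prod (h.smooth.contMDiffAt.mdifferentiableAt (by simp)) a b
  have h2 := mfderiv_orbitMap (E := E) (F := F) g x
  have key : ∀ T : E →L[ℝ] F, T = (translationDeriv F g x).comp ((orbitDeriv E F G x).comp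
        (mfderiv 𝓘(ℝ, E) 𝓘(ℝ, E) (fun k : G => g⁻¹ * k) g : E →L[ℝ] E)) →
      b (T (πG g (a.comp T))) =
        leftPairing πG g ((a.comp (translationDeriv F g x)).comp (orbitDeriv E F G x))
          ((b.comp (translationDeriv F g x)).comp (orbitDeriv E F G x)) := by
    rintro T rfl; rfl
  rw [add_comm, ← key _ h2]
  exact h1

end Action

/-! ### The key identity: the algebroid bracket on generators of the action -/

section KeyIdentity

variable {E : Type*} [NormedAddCommGroup E] [NormedSpace ℝ E]
  {F : Type*} [NormedAddCommGroup F] [NormedSpace ℝ F]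
  {G : Type*} [TopologicalSpace G] [ChartedSpace E G] [Group G]
  {M : Type*} [TopologicalSpace M] [ChartedSpace F M] [MulAction G M]

/-- The action in the charts at `1 : G` and `x : M`. -/
def actionInChart (E : Type*) [NormedAddCommGroup E] [NormedSpace ℝ E]
    (F : Type*) [NormedAddCommGroup F] [NormedSpace ℝ F]
    (G : Type*) [TopologicalSpace G] [ChartedSpace E G] [Group G]
    {M : Type*} [TopologicalSpace M] [ChartedSpace F M] [MulAction G M] (x : M) (p : E × F) : F :=
  extChartAt 𝓘(ℝ, F) x
    ((extChartAt 𝓘(ℝ, E) (1 : G)).symm p.1 • (extChartAt 𝓘(ℝ, F) x).symm p.2)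

theorem actionInChart_one (x : M) {e : F} (he : e ∈ (extChartAt 𝓘(ℝ, F) x).target) :
    actionInChart E F G x (extChartAt 𝓘(ℝ, E) (1 : G) 1, e) = e := by
  unfold actionInChart
  simp only [extChartAt_to_inv, one_smul]
  exact (extChartAt 𝓘(ℝ, F) x).right_inv he

variable [LieGroup 𝓘(ℝ, E) ∞ G] [IsManifold 𝓘(ℝ, F) ∞ M]
  [ContMDiffSMul 𝓘(ℝ, E) 𝓘(ℝ, F) ∞ G M]

theorem contDiffAt_actionInChart (x : M) {e : F} (he : e ∈ (extChartAt 𝓘(ℝ, F) x).target) :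
    ContDiffAt ℝ ∞ (actionInChart E F G x) (extChartAt 𝓘(ℝ, E) (1 : G) 1, e) := by
  rw [← contMDiffAt_iff_contDiffAt]
  have h1 : ContMDiffAt 𝓘(ℝ, E × F) 𝓘(ℝ, E) ∞
      (fun p : E × F => (extChartAt 𝓘(ℝ, E) (1 : G)).symm p.1)
      (extChartAt 𝓘(ℝ, E) (1 : G) 1, e) :=
    (contMDiffAt_chart_symm (mem_extChartAt_target (I := 𝓘(ℝ, E)) (1 : G))).comp
      (extChartAt 𝓘(ℝ, E) (1 : G) 1, e) contDiffAt_fst.contMDiffAt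
  have h2 : ContMDiffAt 𝓘(ℝ, E × F) 𝓘(ℝ, F) ∞
      (fun p : E × F => (extChartAt 𝓘(ℝ, F) x).symm p.2)
      (extChartAt 𝓘(ℝ, E) (1 : G) 1, e) :=
    (contMDiffAt_chart_symm he).comp
      (extChartAt 𝓘(ℝ, E) (1 : G) 1, e) contDiffAt_snd.contMDiffAt
  have h3 := (ContMDiffSMul.contMDiff_smul (I := 𝓘(ℝ, E)) (I' := 𝓘(ℝ, F)) (n := ∞) (G := G)
    (M := M)).contMDiffAt.comp (extChartAt 𝓘(ℝ, E) (1 : G) 1, e) (h1.prodMk h2)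
  have h4 : (extChartAt 𝓘(ℝ, E) (1 : G)).symm (extChartAt 𝓘(ℝ, E) (1 : G) 1) •
      (extChartAt 𝓘(ℝ, F) x).symm e ∈ (extChartAt 𝓘(ℝ, F) x).source := by
    rw [extChartAt_to_inv, one_smul]
    exact (extChartAt 𝓘(ℝ, F) x).map_target he
  exact (contMDiffAt_chart h4).comp (extChartAt 𝓘(ℝ, E) (1 : G) 1, e) h3

theorem eventually_differentiableAt_actionInChart (x : M) :
    ∀ᶠ p in 𝓝 (extChartAt 𝓘(ℝ, E) (1 : G) 1, extChartAt 𝓘(ℝ, F) x x),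
      DifferentiableAt ℝ (actionInChart E F G x) p := by
  filter_upwards [((contDiffAt_actionInChart (E := E) (F := F) (G := G) x
    (mem_extChartAt_target (I := 𝓘(ℝ, F)) x)).of_le (m := 1) (by norm_cast)).eventually (by simp)] with p hp
  exact hp.differentiableAt (by simp)

theorem fderiv_actionInChart_inr (x : M) (v : F) :
    fderiv ℝ (actionInChart E F G x) (extChartAt 𝓘(ℝ, E) (1 : G) 1, extChartAt 𝓘(ℝ, F) x x)
      (0, v) = v := by
  have hd := (eventually_differentiableAt_actionInChart (E := E) (F := F) (G := G) x).self_of_nhds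
  have h1 := hd.hasFDerivAt.comp (extChartAt 𝓘(ℝ, F) x x)
    (hasFDerivAt_prodMk_right (extChartAt 𝓘(ℝ, E) (1 : G) 1) (extChartAt 𝓘(ℝ, F) x x))
  have h2 : HasFDerivAt (fun e : F => actionInChart E F G x (extChartAt 𝓘(ℝ, E) (1 : G) 1, e))
      (ContinuousLinearMap.id ℝ F) (extChartAt 𝓘(ℝ, F) x x) := by
    refine (hasFDerivAt_id _).congr_of_eventuallyEq ?_
    filter_upwards [eventually_mem_target (E := F) x] with e he
    exact actionInChart_one x he
  exact congrArg (fun T : F →L[ℝ] F => T v) (h1.unique h2)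

theorem fderiv_actionInChart_inl (x : M) {e : F} (he : e ∈ (extChartAt 𝓘(ℝ, F) x).target)
    (X : E) :
    fderiv ℝ (actionInChart E F G x) (extChartAt 𝓘(ℝ, E) (1 : G) 1, e) (X, 0) =
      mfderiv 𝓘(ℝ, F) 𝓘(ℝ, F) (extChartAt 𝓘(ℝ, F) x) ((extChartAt 𝓘(ℝ, F) x).symm e)
        (orbitDeriv E F G ((extChartAt 𝓘(ℝ, F) x).symm e) X) := by
  have hd := (contDiffAt_actionInChart (E := E) (F := F) (G := G) x he).differentiableAt (by simp)
  have h0 : HasFDerivAt (fun u : E => (u, e)) (ContinuousLinearMap.inl ℝ E F)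
      (extChartAt 𝓘(ℝ, E) (1 : G) 1) := hasFDerivAt_prodMk_left _ e
  have h1 := hd.hasFDerivAt.comp (extChartAt 𝓘(ℝ, E) (1 : G) 1) h0
  set y := (extChartAt 𝓘(ℝ, F) x).symm e with hy
  have hys : y ∈ (extChartAt 𝓘(ℝ, F) x).source := (extChartAt 𝓘(ℝ, F) x).map_target he
  have h2 : MDifferentiableAt 𝓘(ℝ, E) 𝓘(ℝ, F) (fun k : G => k • y) 1 :=
    (contMDiff_orbitMap E F y).contMDiffAt.mdifferentiableAt (by simp)
  have h3 : MDifferentiableAt 𝓘(ℝ, F) 𝓘(ℝ, F) (extChartAt 𝓘(ℝ, F) x) ((1 : G) • y) :=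
    mdifferentiableAt_chart (by rwa [one_smul])
  have h4 := hasFDerivAt_comp_chart_symm_self (h3.comp (1 : G) h2)
  have h5 := h3.hasMFDerivAt.comp (1 : G) h2.hasMFDerivAt
  have key : ∀ z : M, z = y → ∀ w : F,
      (mfderiv 𝓘(ℝ, F) 𝓘(ℝ, F) (extChartAt 𝓘(ℝ, F) x) z w : F) =
      mfderiv 𝓘(ℝ, F) 𝓘(ℝ, F) (extChartAt 𝓘(ℝ, F) x) y w := by
    rintro z rfl w; rfl
  refine (congrArg (fun T : E →L[ℝ] F => T X) (h1.unique h4)).trans ?_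
  refine (congrArg (fun T : E →L[ℝ] F => T X) h5.mfderiv).trans ?_
  exact key _ (one_smul G y) _

/-- In the charts, the pullback of a one-form under the action of `g` is `pullbackAlong`. -/
theorem pullbackAlong_actionInChart (α : CovectorField 𝓘(ℝ, F) M) (x : M) :
    ∀ᶠ u in 𝓝 (extChartAt 𝓘(ℝ, E) (1 : G) 1),
      pullbackAlong (actionInChart E F G x) (formInChart α x) (extChartAt 𝓘(ℝ, F) x x) u =
        (show F →L[ℝ] ℝ from α ((extChartAt 𝓘(ℝ, E) (1 : G)).symm u • x)).comp
          (translationDeriv F ((extChartAt 𝓘(ℝ, E) (1 : G)).symm u) x) := by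
  have hc : Tendsto (fun u : E => (u, extChartAt 𝓘(ℝ, F) x x)) (𝓝 (extChartAt 𝓘(ℝ, E) (1 : G) 1))
      (𝓝 (extChartAt 𝓘(ℝ, E) (1 : G) 1, extChartAt 𝓘(ℝ, F) x x)) :=
    Continuous.tendsto (by fun_prop) _
  have hsrc : ∀ᶠ u in 𝓝 (extChartAt 𝓘(ℝ, E) (1 : G) 1),
      (extChartAt 𝓘(ℝ, E) (1 : G)).symm u • x ∈ (extChartAt 𝓘(ℝ, F) x).source := by
    refine eventually_chart_symm (x := (1 : G))
      (p := fun g => g • x ∈ (extChartAt 𝓘(ℝ, F) x).source) ?_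
    have h := (contMDiff_orbitMap E F (G := G) x).continuous.continuousAt (x := (1 : G))
    refine h.eventually ?_
    simp only [one_smul]
    exact eventually_mem_source x
  filter_upwards [hc.eventually (eventually_differentiableAt_actionInChart (E := E) (G := G) x),
    hsrc] with u hu hgx
  set g := (extChartAt 𝓘(ℝ, E) (1 : G)).symm u with hg
  have h1 := hu.hasFDerivAt.comp (extChartAt 𝓘(ℝ, F) x x)
    (hasFDerivAt_prodMk_right u (extChartAt 𝓘(ℝ, F) x x))
  have h2 : MDifferentiableAt 𝓘(ℝ, F) 𝓘(ℝ, F) (fun y : M => g • y) x :=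
    (contMDiff_translation E F g).contMDiffAt.mdifferentiableAt (by simp)
  have h3 : MDifferentiableAt 𝓘(ℝ, F) 𝓘(ℝ, F) (extChartAt 𝓘(ℝ, F) x) (g • x) :=
    mdifferentiableAt_chart hgx
  have h4 := hasFDerivAt_comp_chart_symm_self (h3.comp x h2)
  have h5 := h3.hasMFDerivAt.comp x h2.hasMFDerivAt
  ext v
  have h6 : fderiv ℝ (actionInChart E F G x) (u, extChartAt 𝓘(ℝ, F) x x) (0, v) =
      mfderiv 𝓘(ℝ, F) 𝓘(ℝ, F) (extChartAt 𝓘(ℝ, F) x) (g • x) (translationDeriv F g x v) :=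
    (congrArg (fun T : F →L[ℝ] F => T v) (h1.unique h4)).trans
      (congrArg (fun T : F →L[ℝ] F => T v) h5.mfderiv)
  have h7 : actionInChart E F G x (u, extChartAt 𝓘(ℝ, F) x x) =
      extChartAt 𝓘(ℝ, F) x (g • x) := by
    simp [actionInChart, hg]
  change formInChart α x (actionInChart E F G x (u, extChartAt 𝓘(ℝ, F) x x))
    (fderiv ℝ (actionInChart E F G x) (u, extChartAt 𝓘(ℝ, F) x x) (0, v)) = _
  rw [h6, h7]
  exact formInChart_mfderiv_chart α hgx _

variable [FiniteDimensional ℝ E] [T2Space G] [FiniteDimensional ℝ F] [T2Space M]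

/-- For a Poisson action, and one-forms `α`, `β` that vanish near `x` on the generator `X_M`, the
bracket `[α, β]` on `X_M` is given by the bracket of `𝔤*`. -/
theorem formBracket_orbitDeriv {πG : BivectorField 𝓘(ℝ, E) G} (hG : IsPoissonLie πG)
    {π : BivectorField 𝓘(ℝ, F) M} (hM : IsPoisson π) (hact : IsPoissonAction πG π)
    {α β : CovectorField 𝓘(ℝ, F) M} {x : M} {X : E}
    (hα : DifferentiableAt ℝ (formInChart α x) (extChartAt 𝓘(ℝ, F) x x))
    (hβ : DifferentiableAt ℝ (formInChart β x) (extChartAt 𝓘(ℝ, F) x x))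
    (hαX : ∀ᶠ y in 𝓝 x, α y (orbitDeriv E F G y X) = 0)
    (hβX : ∀ᶠ y in 𝓝 x, β y (orbitDeriv E F G y X) = 0) :
    formBracket π α β x (orbitDeriv E F G x X) =
      dualBracket πG (ContinuousLinearMap.comp (α x : F →L[ℝ] ℝ) (orbitDeriv E F G x))
        (ContinuousLinearMap.comp (β x : F →L[ℝ] ℝ) (orbitDeriv E F G x)) X := by
  set u₀ := extChartAt 𝓘(ℝ, E) (1 : G) 1 with hu₀
  set e₀ := extChartAt 𝓘(ℝ, F) x x with he₀
  set s := actionInChart E F G x with hs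
  have he : e₀ ∈ (extChartAt 𝓘(ℝ, F) x).target := mem_extChartAt_target x
  have hsC : ContDiffAt ℝ ∞ s (u₀, e₀) := contDiffAt_actionInChart x he
  have hs1 : s (u₀, e₀) = e₀ := actionInChart_one x he
  have hid : ∀ v, fderiv ℝ s (u₀, e₀) (0, v) = v := fderiv_actionInChart_inr x
  have hXM : fderiv ℝ s (u₀, e₀) (X, 0) = orbitDeriv E F G x X := by
    rw [hs, he₀, fderiv_actionInChart_inl x he, extChartAt_to_inv]
    exact mfderiv_chart_self x _
  have hvan : ∀ γ : CovectorField 𝓘(ℝ, F) M, (∀ᶠ y in 𝓝 x, γ y (orbitDeriv E F G y X) = 0) →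
      ∀ᶠ e in 𝓝 e₀, formInChart γ x e (fderiv ℝ s (u₀, e) (X, 0)) = 0 := by
    intro γ hγ
    filter_upwards [eventually_chart_symm (E := F) hγ, eventually_mem_target (E := F) x] with e h1 h2
    rw [hs, fderiv_actionInChart_inl x h2, ← h1,
      ← formInChart_mfderiv_chart γ ((extChartAt 𝓘(ℝ, F) x).map_target h2),
      (extChartAt 𝓘(ℝ, F) x).right_inv h2]
  -- `P γ u` is the pullback g*γ at `x`, where g has chart coordinate `u`; all these covectors live
  -- in one fixed space, so they can be differentiated in `u`.
  let P : CovectorField 𝓘(ℝ, F) M → E → F →L[ℝ] ℝ := fun γ => pullbackAlong s (formInChart γ x) e₀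
  have hP0 : ∀ γ, P γ u₀ = γ x := by
    intro γ
    ext v
    change formInChart γ x (s (u₀, e₀)) (fderiv ℝ s (u₀, e₀) (0, v)) = _
    rw [hs1, hid, he₀, formInChart_self]
  have hPd : ∀ γ : CovectorField 𝓘(ℝ, F) M, DifferentiableAt ℝ (formInChart γ x) e₀ →
      DifferentiableAt ℝ (P γ) u₀ := fun γ hγ => differentiableAt_pullbackAlong hsC hs1 hγ
  have hPX : ∀ γ : CovectorField 𝓘(ℝ, F) M, DifferentiableAt ℝ (formInChart γ x) e₀ →
      (∀ᶠ y in 𝓝 x, γ y (orbitDeriv E F G y X) = 0) →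
      ∀ v : F, fderiv ℝ (P γ) u₀ X v = extD γ x (orbitDeriv E F G x X) v := by
    intro γ hγ hγX v
    refine (fderiv_pullbackAlong hsC hs1 hid hγ X (hvan γ hγX) v).trans ?_
    rw [hXM]
    rfl
  let sharp : (F →L[ℝ] ℝ) →L[ℝ] F :=
    LinearMap.toContinuousLinearMap (show (F →L[ℝ] ℝ) →ₗ[ℝ] F from π x)
  -- The Poisson property of the action with g as a variable near 1. The identity results from
  -- differentiating both sides at `u₀` in the direction `X`.
  have hloc : (fun u => (fun k : G => β (k • x) (π (k • x) (α (k • x))))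
      ((extChartAt 𝓘(ℝ, E) (1 : G)).symm u)) =ᶠ[𝓝 u₀] fun u =>
      P β u (sharp (P α u)) + leftPairing πG ((extChartAt 𝓘(ℝ, E) (1 : G)).symm u)
        ((P α u).comp (orbitDeriv E F G x)) ((P β u).comp (orbitDeriv E F G x)) := by
    filter_upwards [pullbackAlong_actionInChart (E := E) (G := G) α x,
      pullbackAlong_actionInChart (E := E) (G := G) β x] with u h1 h2
    change _ = pullbackAlong s (formInChart β x) e₀ u (sharp (pullbackAlong s (formInChart α x) e₀ u)) +
      leftPairing πG _ ((pullbackAlong s (formInChart α x) e₀ u).comp (orbitDeriv E F G x))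
        ((pullbackAlong s (formInChart β x) e₀ u).comp (orbitDeriv E F G x))
    rw [h1, h2]
    exact hact.apply _ x _ _
  set Ψ : M → ℝ := fun y => β y (π y (α y)) with hΨdef
  have hΨ : MDifferentiableAt 𝓘(ℝ, F) 𝓘(ℝ, ℝ) Ψ ((1 : G) • x) := by
    rw [one_smul]
    exact hM.mdifferentiableAt_pairing hα hβ
  have horb : MDifferentiableAt 𝓘(ℝ, E) 𝓘(ℝ, F) (fun k : G => k • x) 1 :=
    (contMDiff_orbitMap E F x).contMDiffAt.mdifferentiableAt (by simp)
  let m : E →L[ℝ] ℝ := mvfderiv 𝓘(ℝ, E) (fun k : G => Ψ (k • x)) 1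
  have hd1 : HasFDerivAt (fun u => (fun k : G => Ψ (k • x)) ((extChartAt 𝓘(ℝ, E) (1 : G)).symm u))
      m u₀ :=
    hasFDerivAt_comp_chart_symm_self
      (MDifferentiableAt.comp (g := Ψ) (f := fun k : G => k • x) (1 : G) hΨ horb)
  have hd1' := hd1.congr_of_eventuallyEq hloc.symm
  let D : E →L[ℝ] ℝ := dualBracket πG ((P α u₀).comp (orbitDeriv E F G x))
    ((P β u₀).comp (orbitDeriv E F G x))
  have hD : HasFDerivAt (fun u => leftPairing πG ((extChartAt 𝓘(ℝ, E) (1 : G)).symm u)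
      ((P α u).comp (orbitDeriv E F G x)) ((P β u).comp (orbitDeriv E F G x))) D u₀ :=
    hG.hasFDerivAt_leftPairing_comp
      ((hPd α hα).clm_comp (differentiableAt_const (orbitDeriv E F G x)))
      ((hPd β hβ).clm_comp (differentiableAt_const (orbitDeriv E F G x)))
  have hd2 := ((hPd β hβ).hasFDerivAt.clm_apply
    (sharp.hasFDerivAt.comp u₀ (hPd α hα).hasFDerivAt)).add hD
  have hX := congrArg (fun T : E →L[ℝ] ℝ => T X) (hd1'.unique hd2)
  have hleft : m X =
      mvfderiv 𝓘(ℝ, F) Ψ x (orbitDeriv E F G x X) := by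
    have key : ∀ z : M, z = x → ∀ w : F, (mvfderiv 𝓘(ℝ, F) Ψ z : F →L[ℝ] ℝ) w =
        (mvfderiv 𝓘(ℝ, F) Ψ x : F →L[ℝ] ℝ) w := by
      rintro z rfl w; rfl
    refine Eq.trans ?_ (key _ (one_smul G x) _)
    exact congrArg (fun T : E →L[ℝ] ℝ => T X) (hΨ.hasMFDerivAt.comp (1 : G) horb.hasMFDerivAt).mfderiv
  have hX' : mvfderiv 𝓘(ℝ, F) Ψ x (orbitDeriv E F G x X) =
      P β u₀ (sharp (fderiv ℝ (P α) u₀ X)) + fderiv ℝ (P β) u₀ X (sharp (P α u₀)) +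
        dualBracket πG ((P α u₀).comp (orbitDeriv E F G x))
          ((P β u₀).comp (orbitDeriv E F G x)) X := hleft.symm.trans hX
  rw [hP0, hP0] at hX'
  have h1 : fderiv ℝ (P β) u₀ X (sharp (α x)) = - extD β x (π x (α x)) (orbitDeriv E F G x X) :=
    (hPX β hβ hβX _).trans (extD_swap (E := F) β x _ _)
  -- Skew-symmetry of `π` moves the differentiated covector into the outer slot, where Cartan's
  -- formula `hPX` applies.
  have h2 : (β x : F →L[ℝ] ℝ) (sharp (fderiv ℝ (P α) u₀ X)) =
      extD α x (π x (β x)) (orbitDeriv E F G x X) := by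
    refine (hM.skew (β x) (show F →L[ℝ] ℝ from fderiv ℝ (P α) u₀ X)).trans ?_
    refine (congrArg Neg.neg (hPX α hα hαX _)).trans ?_
    exact (extD_swap (E := F) α x _ _).symm
  have key : ∀ m p q d a b : ℝ, m = p + q + d → q = -b → p = a → b - a + m = d := by
    intros; linarith
  exact key _ _ _ _ _ _ hX' h1 h2

end KeyIdentity

/-! ### Algebra of smooth forms and smoothness of determinants -/

section SmoothForms

variable {F : Type*} [NormedAddCommGroup F] [NormedSpace ℝ F]
  {M : Type*} [TopologicalSpace M] [ChartedSpace F M]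

theorem contMDiff_det {r : ℕ} {A : M → Matrix (Fin r) (Fin r) ℝ}
    (hA : ∀ i j, ContMDiff 𝓘(ℝ, F) 𝓘(ℝ, ℝ) ∞ (fun y => A y i j)) :
    ContMDiff 𝓘(ℝ, F) 𝓘(ℝ, ℝ) ∞ (fun y => (A y).det) := by
  have h1 : ContDiff ℝ ∞ (fun B : Fin r → Fin r → ℝ => (Matrix.of B).det) := by
    simp only [Matrix.det_apply, Matrix.of_apply]
    refine ContDiff.sum fun σ _ => ContDiff.const_smul _ (contDiff_prod fun i _ => ?_)
    fun_prop
  have h2 : ContMDiff 𝓘(ℝ, F) 𝓘(ℝ, Fin r → Fin r → ℝ) ∞ (fun y i j => A y i j) :=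
    contMDiff_pi_space.2 fun i => contMDiff_pi_space.2 fun j => hA i j
  exact h1.contMDiff.comp h2

/-- Cramer's numerators are determinants, so using them instead of the solution itself avoids
dividing by a determinant that may vanish away from the point of interest. -/
theorem contMDiff_cramer {r : ℕ} {A : M → Matrix (Fin r) (Fin r) ℝ} {c : M → Fin r → ℝ}
    (hA : ∀ i j, ContMDiff 𝓘(ℝ, F) 𝓘(ℝ, ℝ) ∞ (fun y => A y i j))
    (hc : ∀ i, ContMDiff 𝓘(ℝ, F) 𝓘(ℝ, ℝ) ∞ (fun y => c y i)) (k : Fin r) :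
    ContMDiff 𝓘(ℝ, F) 𝓘(ℝ, ℝ) ∞ (fun y => (A y).cramer (c y) k) := by
  simp only [Matrix.cramer_apply]
  refine contMDiff_det fun i j => ?_
  by_cases h : j = k
  · subst h; simpa using hc i
  · simpa [Matrix.updateCol_apply, h] using hA i j

variable [IsManifold 𝓘(ℝ, F) ∞ M]

theorem IsSmoothForm.smul {f : M → ℝ} (hf : ContMDiff 𝓘(ℝ, F) 𝓘(ℝ, ℝ) ∞ f)
    {α : CovectorField 𝓘(ℝ, F) M} (hα : IsSmoothForm α) :
    IsSmoothForm (fun y => f y • α y) := by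
  refine isSmoothForm_iff.2 fun x => ?_
  refine (hf.contMDiffAt.smul (isSmoothForm_iff.1 hα x)).congr_of_eventuallyEq ?_
  filter_upwards [eventually_mem_source (E := F) x] with y hy
  conv_rhs => rw [← (extChartAt 𝓘(ℝ, F) x).left_inv hy]
  change _ = f _ • formInChart α x (extChartAt 𝓘(ℝ, F) x ((extChartAt 𝓘(ℝ, F) x).symm
    (extChartAt 𝓘(ℝ, F) x y)))
  rw [(extChartAt 𝓘(ℝ, F) x).right_inv ((extChartAt 𝓘(ℝ, F) x).map_source hy)]
  rfl

theorem IsSmoothForm.sub {α β : CovectorField 𝓘(ℝ, F) M} (hα : IsSmoothForm α)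
    (hβ : IsSmoothForm β) : IsSmoothForm (fun y => α y - β y) :=
  isSmoothForm_iff.2 fun x => (isSmoothForm_iff.1 hα x).sub (isSmoothForm_iff.1 hβ x)

theorem IsSmoothForm.add {α β : CovectorField 𝓘(ℝ, F) M} (hα : IsSmoothForm α)
    (hβ : IsSmoothForm β) : IsSmoothForm (fun y => α y + β y) :=
  isSmoothForm_iff.2 fun x => (isSmoothForm_iff.1 hα x).add (isSmoothForm_iff.1 hβ x)

theorem isSmoothForm_zero : IsSmoothForm (fun y : M => (0 : Cotangent 𝓘(ℝ, F) y)) :=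
  isSmoothForm_iff.2 fun _ => contMDiffAt_const (c := (0 : F →L[ℝ] ℝ))

theorem IsSmoothForm.sum {ι : Type*} (s : Finset ι) {α : ι → CovectorField 𝓘(ℝ, F) M}
    (hα : ∀ i, IsSmoothForm (α i)) : IsSmoothForm (fun y => ∑ i ∈ s, α i y) := by
  classical
  induction s using Finset.induction_on with
  | empty => simpa using isSmoothForm_zero
  | insert i s hi ih =>
    simp only [Finset.sum_insert hi]
    exact (hα i).add ih

end SmoothForms

/-! ### Linear algebra of annihilators -/

section Annihilator

variable {F : Type*} [NormedAddCommGroup F] [NormedSpace ℝ F] [FiniteDimensional ℝ F]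
  {M : Type*} [TopologicalSpace M] [ChartedSpace F M]

/-- Cramer's rule: the combination of `φ₀` and the `φ j` that vanishes on the span of the `v i`. -/
theorem cramer_combination_eq_zero {r : ℕ} (φ₀ : F →L[ℝ] ℝ) (φ : Fin r → F →L[ℝ] ℝ) (v : Fin r → F)
    {A : Matrix (Fin r) (Fin r) ℝ} (hA : ∀ i j, A i j = φ j (v i)) (hdet : A.det ≠ 0)
    {W : Submodule ℝ F} (hW : Module.finrank ℝ W = r) (hv : ∀ i, v i ∈ W) {x : F} (hx : x ∈ W) :
    (A.det • φ₀ - ∑ j, A.cramer (fun i => φ₀ (v i)) j • φ j) x = 0 := by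
  have hT : ∀ i, (A.det • φ₀ - ∑ j, A.cramer (fun i => φ₀ (v i)) j • φ j) (v i) = 0 := by
    intro i
    have h1 : ∑ j, A i j * A.cramer (fun i => φ₀ (v i)) j = A.det * φ₀ (v i) :=
      congrFun (Matrix.mulVec_cramer A (fun i => φ₀ (v i))) i
    simp only [hA] at h1
    have h2 : (∑ j, A.cramer (fun i => φ₀ (v i)) j • φ j) (v i) =
        ∑ j, φ j (v i) * A.cramer (fun i => φ₀ (v i)) j := by
      refine (sum_apply _ _ _).trans (Finset.sum_congr rfl fun j _ => mul_comm _ _)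
    change A.det * φ₀ (v i) - (∑ j, A.cramer (fun i => φ₀ (v i)) j • φ j) (v i) = 0
    rw [h2, h1, sub_self]
  let V : Fin r → W := fun i => ⟨v i, hv i⟩
  -- A nonsingular matrix of pairings with the `φ j` forces the `v i` to be independent; there are
  -- `r = dim W` of them, so they span `W`.
  have hVind : LinearIndependent ℝ V := by
    rw [Fintype.linearIndependent_iff]
    intro g hg
    refine congrFun (Matrix.eq_zero_of_vecMul_eq_zero hdet (v := g) ?_)
    funext j
    have h1 := congrArg (fun w : W => φ j (w : F)) hg
    simpa [V, Matrix.vecMul, dotProduct, hA] using h1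
  have hspan := hVind.span_eq_top_of_card_eq_finrank' (by simp [hW])
  have hx' : (⟨x, hx⟩ : W) ∈ Submodule.span ℝ (Set.range V) := by rw [hspan]; trivial
  have hle : Submodule.span ℝ (Set.range V) ≤ LinearMap.ker
      ((A.det • φ₀ - ∑ j, A.cramer (fun i => φ₀ (v i)) j • φ j : F →L[ℝ] ℝ).toLinearMap.comp
        W.subtype) := by
    rw [Submodule.span_le]
    rintro _ ⟨i, rfl⟩
    exact hT i
  exact hle hx'

theorem finrank_annihilator {x : M} (W : Submodule ℝ (TangentSpace 𝓘(ℝ, F) x)) :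
    Module.finrank ℝ (annihilator 𝓘(ℝ, F) W) = Module.finrank ℝ F - Module.finrank ℝ W := by
  let W' : Submodule ℝ F := W
  have h1 := Subspace.finrank_add_finrank_dualAnnihilator_eq W'
  let e : (F →ₗ[ℝ] ℝ) ≃ₗ[ℝ] (F →L[ℝ] ℝ) := LinearMap.toContinuousLinearMap
  have h2 : (annihilator 𝓘(ℝ, F) W : Submodule ℝ (F →L[ℝ] ℝ)) =
      W'.dualAnnihilator.map (e : (F →ₗ[ℝ] ℝ) →ₗ[ℝ] (F →L[ℝ] ℝ)) := by
    refine Submodule.ext (M := F →L[ℝ] ℝ) fun a => Iff.trans ?_ Submodule.mem_map.symm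
    constructor
    · intro ha
      refine ⟨ContinuousLinearMap.toLinearMap (a : F →L[ℝ] ℝ), ?_, ?_⟩
      · rw [Submodule.mem_dualAnnihilator]
        exact fun v hv => ha v hv
      · ext v; rfl
    · rintro ⟨l, hl, rfl⟩ v hv
      exact (Submodule.mem_dualAnnihilator l).1 hl v hv
  have h3 : Module.finrank ℝ (annihilator 𝓘(ℝ, F) W) = Module.finrank ℝ W'.dualAnnihilator := by
    refine Eq.trans ?_ (LinearEquiv.finrank_map_eq e W'.dualAnnihilator)
    exact congrArg (fun S : Submodule ℝ (F →L[ℝ] ℝ) => Module.finrank ℝ S) h2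
  have h4 : Module.finrank ℝ W' = Module.finrank ℝ W := rfl
  omega

end Annihilator

/-! ### Smooth sections of the annihilator of the orbit distribution -/

section Sections

variable {E : Type*} [NormedAddCommGroup E] [NormedSpace ℝ E]
  {F : Type*} [NormedAddCommGroup F] [NormedSpace ℝ F]
  {G : Type*} [TopologicalSpace G] [ChartedSpace E G] [Group G]
  {M : Type*} [TopologicalSpace M] [ChartedSpace F M] [MulAction G M]

theorem mem_orbitDistribution_iff (K : Subgroup G) (x : M) (v : TangentSpace 𝓘(ℝ, F) x) :
    v ∈ orbitDistribution E F K x ↔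
      ∃ X ∈ subgroupLieAlgebra (E := E) K, orbitDeriv E F G x X = v :=
  Iff.rfl

variable [LieGroup 𝓘(ℝ, E) ∞ G] [IsManifold 𝓘(ℝ, F) ∞ M] [ContMDiffSMul 𝓘(ℝ, E) 𝓘(ℝ, F) ∞ G M]

variable (G) in
/-- The derivative of a smooth function along the generators of the action is smooth. -/
theorem contMDiff_mvfderiv_orbitDeriv {f : M → ℝ} (hf : ContMDiff 𝓘(ℝ, F) 𝓘(ℝ, ℝ) ∞ f) (X : E) :
    ContMDiff 𝓘(ℝ, F) 𝓘(ℝ, ℝ) ∞ (fun y => mvfderiv 𝓘(ℝ, F) f y (orbitDeriv E F G y X)) := by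
  intro x
  have hα := contDiffAt_formInChart (isSmoothForm_mvfderiv hf) x
  have hs := contDiffAt_actionInChart (E := E) (F := F) (G := G) x
    (mem_extChartAt_target (I := 𝓘(ℝ, F)) x)
  have hs' : ContDiffAt ℝ ∞ (fun e => fderiv ℝ (actionInChart E F G x)
      (extChartAt 𝓘(ℝ, E) (1 : G) 1, e)) (extChartAt 𝓘(ℝ, F) x x) :=
    ContDiffAt.comp (extChartAt 𝓘(ℝ, F) x x) (hs.fderiv_right (m := ∞) (by norm_cast))
      (contDiffAt_const.prodMk contDiffAt_id)
  have h := hα.clm_apply (hs'.clm_apply (contDiffAt_const (c := (X, (0 : F)))))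
  refine ContMDiffAt.congr_of_eventuallyEq (h.contMDiffAt.comp x
    (contMDiffAt_chart (mem_extChartAt_source (I := 𝓘(ℝ, F)) x))) ?_
  filter_upwards [eventually_mem_source (E := F) x] with y hy
  simp only [Function.comp_apply]
  rw [fderiv_actionInChart_inl x ((extChartAt 𝓘(ℝ, F) x).map_source hy),
    (extChartAt 𝓘(ℝ, F) x).left_inv hy]
  exact (formInChart_mfderiv_chart _ hy _).symm

variable [FiniteDimensional ℝ F] [T2Space M]

/-- Choose generators forming a basis of the distribution at `x`, functions whose differentials at
`x` are dual to it, and `f₀` with df₀ = a at `x`. Cramer's rule corrects df₀ to a smooth form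
vanishing on the chosen generators. Where the determinant is nonzero and the rank is that at `x`,
these span the distribution; a cutoff removes the rest of `M`. At `x` the matrix is 1 and the
right-hand side 0, so the value remains `a`. -/
theorem exists_smooth_section_annihilator (K : Subgroup G)
    (hrank : IsLocallyConstant (fun x : M => Module.finrank ℝ (orbitDistribution E F K x)))
    (x : M) (a : Cotangent 𝓘(ℝ, F) x)
    (ha : a ∈ annihilator 𝓘(ℝ, F) (orbitDistribution E F K x)) :
    ∃ α : CovectorField 𝓘(ℝ, F) M, IsSmoothForm α ∧
      (∀ y, α y ∈ annihilator 𝓘(ℝ, F) (orbitDistribution E F K y)) ∧ α x = a := by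
  let D : M → Submodule ℝ F := fun y => orbitDistribution E F K y
  let d : (M → ℝ) → M → F →L[ℝ] ℝ := fun f y => mvfderiv 𝓘(ℝ, F) f y
  let w := Module.finBasis ℝ (D x)
  have hX : ∀ i, ∃ X : E, X ∈ subgroupLieAlgebra (E := E) K ∧ orbitDeriv E F G x X = w i :=
    fun i => (mem_orbitDistribution_iff K x _).1 (w i).2
  choose X hXK hXw using hX
  have hb : ∀ j, ∃ b : F →ₗ[ℝ] ℝ, b.comp (D x).subtype = w.coord j := fun j =>
    LinearMap.exists_extend (w.coord j)
  choose b hb using hb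
  have hbw : ∀ i j, b j (w i) = if i = j then 1 else 0 := fun i j => by
    have := congrArg (fun T : D x →ₗ[ℝ] ℝ => T (w i)) (hb j)
    simpa [Finsupp.single_apply] using this
  have hf : ∀ j, ∃ f : M → ℝ, ContMDiff 𝓘(ℝ, F) 𝓘(ℝ, ℝ) ∞ f ∧
      d f x = (b j).toContinuousLinearMap := fun j =>
    exists_mvfderiv_eq (E := F) x ((b j).toContinuousLinearMap)
  choose f hf hfb using hf
  have hf₀ : ∃ f : M → ℝ, ContMDiff 𝓘(ℝ, F) 𝓘(ℝ, ℝ) ∞ f ∧ d f x = a :=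
    exists_mvfderiv_eq (E := F) x a
  obtain ⟨f₀, hf₀, hfa⟩ := hf₀
  let A : M → Matrix (Fin (Module.finrank ℝ (D x))) (Fin (Module.finrank ℝ (D x))) ℝ := fun y =>
    Matrix.of fun i j => d (f j) y (orbitDeriv E F G y (X i))
  let c : M → Fin (Module.finrank ℝ (D x)) → ℝ := fun y i => d f₀ y (orbitDeriv E F G y (X i))
  have hA : ∀ i j, ContMDiff 𝓘(ℝ, F) 𝓘(ℝ, ℝ) ∞ (fun y => A y i j) := fun i j =>
    contMDiff_mvfderiv_orbitDeriv G (hf j) (X i)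
  have hc : ∀ i, ContMDiff 𝓘(ℝ, F) 𝓘(ℝ, ℝ) ∞ (fun y => c y i) := fun i =>
    contMDiff_mvfderiv_orbitDeriv G hf₀ (X i)
  have hAx : A x = 1 := by
    ext i j
    change d (f j) x (orbitDeriv E F G x (X i)) = _
    rw [hfb, hXw]
    exact (hbw i j).trans (Matrix.one_apply).symm
  have hcx : c x = 0 := by
    funext i
    change d f₀ x (orbitDeriv E F G x (X i)) = 0
    rw [hfa]
    exact ha _ ⟨X i, hXK i, rfl⟩
  have hV : {y | (A y).det ≠ 0 ∧ Module.finrank ℝ (D y) = Module.finrank ℝ (D x)} ∈ 𝓝 x := by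
    have h1 : ∀ᶠ y in 𝓝 x, (A y).det ≠ 0 :=
      (contMDiff_det hA).continuous.continuousAt.eventually_ne (by rw [hAx]; simp)
    exact h1.and (hrank.eventually_eq x)
  obtain ⟨χ, hχ, hχ1, hχs⟩ := exists_cutoff (E := F) hV
  let T : M → F →L[ℝ] ℝ := fun y =>
    χ y • ((A y).det • d f₀ y - ∑ j, (A y).cramer (c y) j • d (f j) y)
  refine ⟨T, ?_, ?_, ?_⟩
  · exact IsSmoothForm.smul hχ (IsSmoothForm.sub
      ((isSmoothForm_mvfderiv hf₀).smul (contMDiff_det hA)) (IsSmoothForm.sum _ fun j =>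
        (isSmoothForm_mvfderiv (hf j)).smul (contMDiff_cramer hA hc j)))
  · intro y
    suffices h : ∀ v ∈ D y, T y v = 0 from h
    intro v hv
    by_cases hy : y ∈ tsupport χ
    swap
    · simp [T, image_eq_zero_of_notMem_tsupport hy]
    obtain ⟨hdet, hfin⟩ := hχs hy
    have h := cramer_combination_eq_zero (d f₀ y) (fun j => d (f j) y)
      (fun i => orbitDeriv E F G y (X i)) (A := A y) (fun _ _ => rfl) hdet hfin
      (fun i => ⟨X i, hXK i, rfl⟩) hv
    exact (congrArg (χ y * ·) h).trans (mul_zero _)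
  · change T x = a
    simp only [T, hAx, hcx, hχ1.self_of_nhds, hfa]
    simp only [Pi.one_apply, Matrix.det_one, map_zero, Pi.zero_apply, zero_smul,
      Finset.sum_const_zero, sub_zero, one_smul]
    exact one_smul ℝ (a : F →L[ℝ] ℝ)

end Sections

/-! ### Subalgebroids of the cotangent algebroid and subalgebras of the dual -/

section Subalgebroid

variable {E : Type*} [NormedAddCommGroup E] [NormedSpace ℝ E] [FiniteDimensional ℝ E]
  {F : Type*} [NormedAddCommGroup F] [NormedSpace ℝ F] [FiniteDimensional ℝ F]
  {G : Type*} [TopologicalSpace G] [T2Space G] [ChartedSpace E G] [Group G] [LieGroup 𝓘(ℝ, E) ∞ G]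
  {M : Type*} [TopologicalSpace M] [T2Space M] [ChartedSpace F M] [IsManifold 𝓘(ℝ, F) ∞ M]
  [MulAction G M] [ContMDiffSMul 𝓘(ℝ, E) 𝓘(ℝ, F) ∞ G M]
  {πG : BivectorField 𝓘(ℝ, E) G} {π : BivectorField 𝓘(ℝ, F) M} {K : Subgroup G}

/-- Near a point where they are smooth, one-forms that annihilate the orbits are closed under the
bracket. -/
theorem formBracket_mem_annihilator (hG : IsPoissonLie πG) (hM : IsPoisson π)
    (hact : IsPoissonAction πG π)
    (hK : IsDualSubalgebra πG (annihilator 𝓘(ℝ, E) (subgroupLieAlgebra (E := E) K)))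
    {α β : CovectorField 𝓘(ℝ, F) M} {x : M}
    (hα : DifferentiableAt ℝ (formInChart α x) (extChartAt 𝓘(ℝ, F) x x))
    (hβ : DifferentiableAt ℝ (formInChart β x) (extChartAt 𝓘(ℝ, F) x x))
    (hαD : ∀ᶠ y in 𝓝 x, α y ∈ annihilator 𝓘(ℝ, F) (orbitDistribution E F K y))
    (hβD : ∀ᶠ y in 𝓝 x, β y ∈ annihilator 𝓘(ℝ, F) (orbitDistribution E F K y)) :
    formBracket π α β x ∈ annihilator 𝓘(ℝ, F) (orbitDistribution E F K x) := by
  rintro v ⟨X, hX, rfl⟩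
  have h := formBracket_orbitDeriv hG hM hact (X := X) hα hβ
    (hαD.mono fun y hy => hy _ ⟨X, hX, rfl⟩) (hβD.mono fun y hy => hy _ ⟨X, hX, rfl⟩)
  refine h.trans (hK _ ?_ _ ?_ X hX)
  · exact fun Y hY => hαD.self_of_nhds _ ⟨Y, hY, rfl⟩
  · exact fun Y hY => hβD.self_of_nhds _ ⟨Y, hY, rfl⟩

theorem isSubalgebroid_annihilator (hG : IsPoissonLie πG) (hM : IsPoisson π)
    (hact : IsPoissonAction πG π)
    (hrank : IsLocallyConstant (fun x : M => Module.finrank ℝ (orbitDistribution E F K x)))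
    (hK : IsDualSubalgebra πG (annihilator 𝓘(ℝ, E) (subgroupLieAlgebra (E := E) K))) :
    IsSubalgebroid π (fun x => annihilator 𝓘(ℝ, F) (orbitDistribution E F K x)) where
  locallyConstant_rank := by
    simp only [finrank_annihilator]
    exact hrank.comp (fun n => Module.finrank ℝ F - n)
  exists_section x a ha := exists_smooth_section_annihilator K hrank x a ha
  closed α β hα hβ hαD hβD y := formBracket_mem_annihilator hG hM hact hK
    ((contDiffAt_formInChart hα y).differentiableAt (by simp))
    ((contDiffAt_formInChart hβ y).differentiableAt (by simp))
    (Eventually.of_forall hαD) (Eventually.of_forall hβD)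

/-- Since d(df) = d(dg) = 0, the algebroid bracket of df and dg is d{f, g}. -/
theorem mvfderiv_bracket_mem_annihilator (hG : IsPoissonLie πG) (hM : IsPoisson π)
    (hact : IsPoissonAction πG π)
    (hK : IsDualSubalgebra πG (annihilator 𝓘(ℝ, E) (subgroupLieAlgebra (E := E) K)))
    {f g : M → ℝ} {x : M}
    (hf : ∀ᶠ y in 𝓝 x, ContMDiffAt 𝓘(ℝ, F) 𝓘(ℝ, ℝ) ∞ f y)
    (hg : ∀ᶠ y in 𝓝 x, ContMDiffAt 𝓘(ℝ, F) 𝓘(ℝ, ℝ) ∞ g y)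
    (hfD : ∀ᶠ y in 𝓝 x, mvfderiv 𝓘(ℝ, F) f y ∈
      annihilator 𝓘(ℝ, F) (orbitDistribution E F K y))
    (hgD : ∀ᶠ y in 𝓝 x, mvfderiv 𝓘(ℝ, F) g y ∈
      annihilator 𝓘(ℝ, F) (orbitDistribution E F K y)) :
    mvfderiv 𝓘(ℝ, F) (bracket π f g) x ∈ annihilator 𝓘(ℝ, F) (orbitDistribution E F K x) := by
  intro v hv
  have h := formBracket_mem_annihilator hG hM hact hK
    (differentiableAt_formInChart_mvfderiv hf) (differentiableAt_formInChart_mvfderiv hg)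
    hfD hgD v hv
  refine Eq.trans ?_ h
  change _ = extD (mvfderiv 𝓘(ℝ, F) g) x (π x (mvfderiv 𝓘(ℝ, F) f x)) v -
    extD (mvfderiv 𝓘(ℝ, F) f) x (π x (mvfderiv 𝓘(ℝ, F) g x)) v +
    mvfderiv 𝓘(ℝ, F) (bracket π f g) x v
  rw [extD_mvfderiv hf, extD_mvfderiv hg]
  simp

/-- One point suffices: there every element of h^⊥ is the pullback of a covector in 𝔥_x^⊥, and the
subbundle supplies sections through these covectors. -/
theorem isDualSubalgebra_of_isSubalgebroid [Nonempty M] (hG : IsPoissonLie πG) (hM : IsPoisson π)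
    (hact : IsPoissonAction πG π)
    (hiso : ∀ x : M, isotropyAlgebra E F G x ≤ subgroupLieAlgebra (E := E) K)
    (hB : IsSubalgebroid π (fun x => annihilator 𝓘(ℝ, F) (orbitDistribution E F K x))) :
    IsDualSubalgebra πG (annihilator 𝓘(ℝ, E) (subgroupLieAlgebra (E := E) K)) := by
  obtain ⟨x⟩ := ‹Nonempty M›
  let h : Submodule ℝ E := subgroupLieAlgebra (E := E) K
  have lift : ∀ ξ : E →L[ℝ] ℝ, (∀ X ∈ h, ξ X = 0) →
      ∃ a : F →L[ℝ] ℝ, a.comp (orbitDeriv E F G x) = ξ := by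
    intro ξ hξ
    -- The kernel of the infinitesimal action at `x` is the isotropy algebra, which lies in h; hence
    -- `ξ` factors through the infinitesimal action.
    have hker : LinearMap.ker (orbitDeriv E F G x).toLinearMap ≤ LinearMap.ker ξ.toLinearMap :=
      fun X hX => hξ X (hiso x hX)
    have hmem : ξ.toLinearMap ∈ LinearMap.range (orbitDeriv E F G x).toLinearMap.dualMap := by
      rw [LinearMap.range_dualMap_eq_dualAnnihilator_ker, Submodule.mem_dualAnnihilator]
      exact fun X hX => hker hX
    obtain ⟨l, hl⟩ := hmem
    exact ⟨LinearMap.toContinuousLinearMap l,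
      ContinuousLinearMap.ext fun X => congrArg (fun m => m X) hl⟩
  intro ξ hξ η hη X hX
  obtain ⟨a, ha⟩ := lift ξ hξ
  obtain ⟨b, hb⟩ := lift η hη
  have hmem : ∀ (ζ : E →L[ℝ] ℝ) (a : F →L[ℝ] ℝ), (∀ X ∈ h, ζ X = 0) →
      a.comp (orbitDeriv E F G x) = ζ →
      (show Cotangent 𝓘(ℝ, F) x from a) ∈ annihilator 𝓘(ℝ, F) (orbitDistribution E F K x) := by
    rintro ζ a hζ rfl v ⟨Y, hY, rfl⟩
    exact hζ Y hY
  obtain ⟨α, hα, hαD, hαx⟩ := hB.exists_section x a (hmem ξ a hξ ha)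
  obtain ⟨β, hβ, hβD, hβx⟩ := hB.exists_section x b (hmem η b hη hb)
  have h1 := formBracket_orbitDeriv hG hM hact (x := x) (X := X)
    ((contDiffAt_formInChart hα x).differentiableAt (by simp))
    ((contDiffAt_formInChart hβ x).differentiableAt (by simp))
    (Eventually.of_forall fun y => hαD y _ ⟨X, hX, rfl⟩)
    (Eventually.of_forall fun y => hβD y _ ⟨X, hX, rfl⟩)
  have h2 := hB.closed α β hα hβ hαD hβD x _ ⟨X, hX, rfl⟩
  rw [hαx, hβx] at h1
  subst ha hb
  exact h1.symm.trans h2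

end Subalgebroid

/-! ### Local structure of submersions -/

section Submersion

variable {F : Type*} [NormedAddCommGroup F] [NormedSpace ℝ F] [FiniteDimensional ℝ F]
  {F' : Type*} [NormedAddCommGroup F'] [NormedSpace ℝ F'] [FiniteDimensional ℝ F']

/-- A smooth map with surjective derivative at `e` is, near `e`, a linear projection. -/
theorem exists_straightening {f : F → F'} {A : F →L[ℝ] F'} {e : F} (hf : ContDiffAt ℝ ∞ f e)
    (hA : HasFDerivAt f A e) (hs : Function.Surjective A) :
    ∃ Ψ : OpenPartialHomeomorph F (F' × A.ker), e ∈ Ψ.source ∧ (∀ z, (Ψ z).1 = f z) ∧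
      ContDiffAt ℝ ∞ Ψ.symm (Ψ e) := by
  have hr : A.range = ⊤ := LinearMap.range_eq_top.2 hs
  -- With a projection `P` onto the kernel of `A`, the map z ↦ (f z, P z) has invertible derivative,
  -- and the inverse function theorem applies.
  obtain ⟨P, hP⟩ := A.ker_closedComplemented_of_finiteDimensional_range
  let L : F ≃L[ℝ] F' × A.ker := ContinuousLinearMap.equivProdOfSurjectiveOfIsCompl A P hr
    (LinearMap.range_eq_of_proj hP) (LinearMap.isCompl_of_proj hP)
  have hL : HasFDerivAt (fun z => (f z, P z)) (L : F →L[ℝ] F' × A.ker) e :=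
    hA.prodMk P.hasFDerivAt
  have hc : ContDiffAt ℝ ∞ (fun z => (f z, P z)) e := hf.prodMk P.contDiff.contDiffAt
  exact ⟨hc.toOpenPartialHomeomorph _ hL (by simp), hc.mem_toOpenPartialHomeomorph_source hL _,
    fun z => rfl, hc.to_localInverse hL (by simp)⟩

variable {M : Type*} [TopologicalSpace M] [ChartedSpace F M] [IsManifold 𝓘(ℝ, F) ∞ M]
  {N : Type*} [TopologicalSpace N] [ChartedSpace F' N] [IsManifold 𝓘(ℝ, F') ∞ N]

/-- The local normal form of a submersion `q`: near `x` there are coordinates `τ`, with inverse `σ`,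
whose first component is the chart of `N` composed with `q`. -/
theorem exists_submersion_coordinates {q : M → N} {x : M}
    (hq : ContMDiffAt 𝓘(ℝ, F) 𝓘(ℝ, F') ∞ q x)
    (hs : Function.Surjective (mfderiv 𝓘(ℝ, F) 𝓘(ℝ, F') q x)) :
    ∃ (W : Submodule ℝ F) (τ : M → F' × W) (σ : F' × W → M), ContinuousAt τ x ∧ σ (τ x) = x ∧
      ContMDiffAt 𝓘(ℝ, F' × W) 𝓘(ℝ, F) ∞ σ (τ x) ∧ (∀ᶠ y in 𝓝 x, σ (τ y) = y) ∧
      (∀ᶠ y in 𝓝 x, (τ y).1 = extChartAt 𝓘(ℝ, F') (q x) (q y)) ∧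
      ∀ᶠ p in 𝓝 (τ x), extChartAt 𝓘(ℝ, F') (q x) (q (σ p)) = p.1 := by
  let φ := extChartAt 𝓘(ℝ, F) x
  let ψ := extChartAt 𝓘(ℝ, F') (q x)
  have hψq : ContMDiffAt 𝓘(ℝ, F) 𝓘(ℝ, F') ∞ (fun y => ψ (q y)) x :=
    (contMDiffAt_extChartAt (I := 𝓘(ℝ, F')) (x := q x)).comp x hq
  have hf : ContDiffAt ℝ ∞ (fun e => ψ (q (φ.symm e))) (φ x) := by
    refine ContMDiffAt.contDiffAt ?_
    have h2 := contMDiffAt_chart_symm (E := F) (mem_extChartAt_target (I := 𝓘(ℝ, F)) x)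
    refine ContMDiffAt.comp (I' := 𝓘(ℝ, F)) (g := fun y => ψ (q y)) (φ x) ?_ h2
    rwa [extChartAt_to_inv]
  have hA := hasFDerivAt_comp_chart_symm_self (hψq.mdifferentiableAt (by simp))
  have hsurj : Function.Surjective (mvfderiv 𝓘(ℝ, F) (fun y => ψ (q y)) x : F →L[ℝ] F') := by
    intro w
    obtain ⟨v, hv⟩ := hs w
    refine ⟨v, ?_⟩
    have h := mfderiv_comp x (mdifferentiableAt_chart (mem_extChartAt_source (I := 𝓘(ℝ, F')) (q x)))
      (hq.mdifferentiableAt (by simp))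
    refine (congrArg (fun T : F →L[ℝ] F' => T v) h).trans ?_
    exact (mfderiv_chart_self (q x) _).trans hv
  obtain ⟨Ψ, he, hfst, hsymm⟩ := exists_straightening hf hA hsurj
  refine ⟨_, fun y => Ψ (φ y), fun p => φ.symm (Ψ.symm p), ?_, ?_, ?_, ?_, ?_, ?_⟩
  · exact (Ψ.continuousAt he).comp (continuousAt_extChartAt x)
  · change φ.symm (Ψ.symm (Ψ (φ x))) = x
    rw [Ψ.left_inv he]
    exact extChartAt_to_inv x
  · refine ContMDiffAt.comp (Ψ (φ x)) ?_ hsymm.contMDiffAt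
    rw [Ψ.left_inv he]
    exact contMDiffAt_chart_symm (mem_extChartAt_target (I := 𝓘(ℝ, F)) x)
  · filter_upwards [(continuousAt_extChartAt x).eventually (Ψ.open_source.mem_nhds he),
      eventually_mem_source (E := F) x] with y hy hys
    rw [Ψ.left_inv hy]
    exact φ.left_inv hys
  · filter_upwards [eventually_mem_source (E := F) x] with y hys
    rw [hfst, φ.left_inv hys]
  · filter_upwards [Ψ.open_target.mem_nhds (Ψ.map_source he)] with p hp
    rw [← hfst, Ψ.right_inv hp]

/-- In submersion coordinates, freeze the fibre coordinate at its value at `x`. -/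
theorem exists_local_section {q : M → N} {x : M}
    (hq : ContMDiffAt 𝓘(ℝ, F) 𝓘(ℝ, F') ∞ q x)
    (hs : Function.Surjective (mfderiv 𝓘(ℝ, F) 𝓘(ℝ, F') q x)) :
    ∃ s : N → M, ContMDiffAt 𝓘(ℝ, F') 𝓘(ℝ, F) ∞ s (q x) ∧ s (q x) = x ∧
      ∀ᶠ y in 𝓝 (q x), q (s y) = y := by
  obtain ⟨W, τ, σ, -, hστ, hσ, -, hfst, hqσ⟩ := exists_submersion_coordinates hq hs
  let ψ := extChartAt 𝓘(ℝ, F') (q x)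
  let j : N → F' × W := fun y => (ψ y, (τ x).2)
  have hj : ContMDiffAt 𝓘(ℝ, F') 𝓘(ℝ, F' × W) ∞ j (q x) :=
    ContMDiffAt.prodMk_space contMDiffAt_extChartAt contMDiffAt_const
  have hjx : j (q x) = τ x := Prod.ext hfst.self_of_nhds.symm rfl
  have hsx : σ (j (q x)) = x := by rw [hjx, hστ]
  have hsm : ContMDiffAt 𝓘(ℝ, F') 𝓘(ℝ, F) ∞ (fun y => σ (j y)) (q x) :=
    ContMDiffAt.comp (q x) (by rwa [hjx]) hj
  refine ⟨fun y => σ (j y), hsm, hsx, ?_⟩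
  have hcont : Tendsto (fun y => q (σ (j y))) (𝓝 (q x)) (𝓝 (q x)) := by
    have h1 := hsm.continuousAt.tendsto
    rw [hsx] at h1
    exact hq.continuousAt.tendsto.comp h1
  have hj' := hj.continuousAt.tendsto
  rw [hjx] at hj'
  filter_upwards [hj'.eventually hqσ, hcont.eventually (eventually_mem_source (E := F') (q x)),
    eventually_mem_source (E := F') (q x)] with y h1 h2 h3
  exact ψ.injOn h2 h3 h1

/-- A function whose differential vanishes on the kernel of a submersion is locally constant along
the fibres. -/
theorem eventually_eq_of_fibre {q : M → N} {x : M} {h : M → ℝ}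
    (hq : ∀ᶠ y in 𝓝 x, ContMDiffAt 𝓘(ℝ, F) 𝓘(ℝ, F') ∞ q y)
    (hs : Function.Surjective (mfderiv 𝓘(ℝ, F) 𝓘(ℝ, F') q x))
    (hh : ∀ᶠ y in 𝓝 x, MDifferentiableAt 𝓘(ℝ, F) 𝓘(ℝ, ℝ) h y)
    (hker : ∀ᶠ y in 𝓝 x, ∀ v : TangentSpace 𝓘(ℝ, F) y,
      mfderiv 𝓘(ℝ, F) 𝓘(ℝ, F') q y v = 0 → mvfderiv 𝓘(ℝ, F) h y v = 0) :
    ∀ᶠ y in 𝓝 x, q y = q x → h y = h x := by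
  obtain ⟨W, τ, σ, hτ, hστ, hσ, hστ', hfst, hqσ⟩ :=
    exists_submersion_coordinates hq.self_of_nhds hs
  let ψ := extChartAt 𝓘(ℝ, F') (q x)
  let i : W → F' × W := fun w => ((τ x).1, w)
  -- `c` parametrizes the fibre of `q` through `x`; its velocities lie in ker dq, so `h ∘ c` has
  -- zero derivative near the coordinate of `x`.
  let c : W → M := fun w => σ (i w)
  have hi : ∀ w, ContMDiffAt 𝓘(ℝ, W) 𝓘(ℝ, F' × W) ∞ i w := fun w =>
    ContDiffAt.contMDiffAt (contDiffAt_const.prodMk contDiffAt_id)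
  have hσ' : ∀ᶠ p in 𝓝 (τ x), ContMDiffAt 𝓘(ℝ, F' × W) 𝓘(ℝ, F) 1 σ p :=
    have : IsManifold 𝓘(ℝ, F) 1 M := inferInstance
    (contMDiffAt_iff_contMDiffAt_nhds (by simp)).1 (hσ.of_le (by norm_cast))
  have hσx : Tendsto σ (𝓝 (τ x)) (𝓝 x) := by
    have := hσ.continuousAt.tendsto
    rwa [hστ] at this
  have hqx : ∀ᶠ y in 𝓝 x, q y ∈ ψ.source :=
    hq.self_of_nhds.continuousAt.eventually (eventually_mem_source (E := F') (q x))
  have hix : Tendsto i (𝓝 (τ x).2) (𝓝 (τ x)) := (hi _).continuousAt.tendsto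
  have hev : ∀ᶠ w in 𝓝 (τ x).2, HasFDerivAt (fun w => h (c w)) (0 : W →L[ℝ] ℝ) w := by
    filter_upwards [hix.eventually hσ', hix.eventually hqσ.eventually_nhds,
      hix.eventually (hσx.eventually hq), hix.eventually (hσx.eventually hh),
      hix.eventually (hσx.eventually hker), hix.eventually (hσx.eventually hqx)]
      with w hσw hqw hqc hhc hkc hcs
    have hc : MDifferentiableAt 𝓘(ℝ, W) 𝓘(ℝ, F) c w :=
      (ContMDiffAt.comp w hσw ((hi w).of_le (by norm_cast))).mdifferentiableAt (by simp)
    have hqd := hqc.mdifferentiableAt (by simp)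
    have hψd := mdifferentiableAt_chart (E := F') hcs
    have hconst : (fun w => ψ (q (c w))) =ᶠ[𝓝 w] fun _ => (τ x).1 :=
      (hi w).continuousAt.eventually hqw
    let dc : W →L[ℝ] F := mfderiv 𝓘(ℝ, W) 𝓘(ℝ, F) c w
    let dq : F →L[ℝ] F' := mfderiv 𝓘(ℝ, F) 𝓘(ℝ, F') q (c w)
    let dψ : F' →L[ℝ] F' := mfderiv 𝓘(ℝ, F') 𝓘(ℝ, F') ψ (q (c w))
    have h1 : HasFDerivAt (fun w => ψ (q (c w))) (dψ.comp (dq.comp dc)) w :=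
      (hψd.hasMFDerivAt.comp w (hqd.hasMFDerivAt.comp w hc.hasMFDerivAt)).hasFDerivAt
    have h2 : HasFDerivAt (fun w => ψ (q (c w))) (0 : W →L[ℝ] F') w :=
      (hasFDerivAt_const (τ x).1 w).congr_of_eventuallyEq hconst
    have h3 := h1.unique h2
    have h4 : HasFDerivAt (fun w => h (c w))
        ((mvfderiv 𝓘(ℝ, F) h (c w) : F →L[ℝ] ℝ).comp dc) w := (hhc.hasMFDerivAt.comp w hc.hasMFDerivAt).hasFDerivAt
    refine h4.congr_fderiv ?_
    refine ContinuousLinearMap.ext fun v => ?_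
    refine hkc _ ?_
    have h5 := congrArg (fun T : W →L[ℝ] F' => T v) h3
    -- Only dψ ∘ dq ∘ dc = 0 is known so far; the derivative of the inverse chart cancels dψ.
    refine (mfderiv_chart_symm_mfderiv_chart hcs _).symm.trans ?_
    refine (congrArg (mfderiv 𝓘(ℝ, F') 𝓘(ℝ, F') ψ.symm (ψ (q (c w))) : F' → F') h5).trans ?_
    exact map_zero (mfderiv 𝓘(ℝ, F') 𝓘(ℝ, F') ψ.symm (ψ (q (c w))) : F' →L[ℝ] F')
  obtain ⟨r, hr, hball⟩ := Metric.eventually_nhds_iff_ball.1 hev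
  have hconst : ∀ w ∈ Metric.ball (τ x).2 r, h (c w) = h (c (τ x).2) := fun w hw =>
    (convex_ball (τ x).2 r).is_const_of_fderivWithin_eq_zero (𝕜 := ℝ) (f := fun w => h (c w))
      (fun z hz => (hball z hz).differentiableAt.differentiableWithinAt)
      (fun z hz => (hball z hz).hasFDerivWithinAt.fderivWithin
        (Metric.isOpen_ball.uniqueDiffWithinAt hz)) hw (Metric.mem_ball_self hr)
  have hτ2 : ∀ᶠ y in 𝓝 x, (τ y).2 ∈ Metric.ball (τ x).2 r :=
    (continuousAt_snd.comp hτ).eventually (Metric.ball_mem_nhds _ hr)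
  have hcx : ∀ y, (τ y).1 = (τ x).1 → c (τ y).2 = σ (τ y) := fun y hy => by
    simp only [c, i, ← hy]
  filter_upwards [hστ', hfst, hτ2] with y h1 h2 h3 hy
  have h4 := hconst _ h3
  rwa [hcx y (by rw [h2, hfst.self_of_nhds, hy]), hcx x rfl, h1, hστ] at h4

end Submersion

/-! ### Brackets of pulled-back functions -/

section Pushforward

variable {F : Type*} [NormedAddCommGroup F] [NormedSpace ℝ F]
  {F' : Type*} [NormedAddCommGroup F'] [NormedSpace ℝ F']
  {M : Type*} [TopologicalSpace M] [ChartedSpace F M]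
  {N : Type*} [TopologicalSpace N] [ChartedSpace F' N]

/-- The pushforward `dq ∘ π^♯ ∘ dq*` of a bivector at `x`, as a map on the model space. -/
def pushforwardBivector (π : BivectorField 𝓘(ℝ, F) M) (q : M → N) (x : M) :
    (F' →L[ℝ] ℝ) →ₗ[ℝ] F' :=
  letI dq : F →L[ℝ] F' := mfderiv 𝓘(ℝ, F) 𝓘(ℝ, F') q x
  letI P : (F →L[ℝ] ℝ) →ₗ[ℝ] F := π x
  dq.toLinearMap ∘ₗ P ∘ₗ ((ContinuousLinearMap.compL ℝ F F' ℝ).flip dq).toLinearMap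

theorem bracket_comp_eq {π : BivectorField 𝓘(ℝ, F) M} {q : M → N} {x : M} {f g : N → ℝ}
    (hq : MDifferentiableAt 𝓘(ℝ, F) 𝓘(ℝ, F') q x)
    (hf : MDifferentiableAt 𝓘(ℝ, F') 𝓘(ℝ, ℝ) f (q x))
    (hg : MDifferentiableAt 𝓘(ℝ, F') 𝓘(ℝ, ℝ) g (q x)) :
    bracket π (fun y => f (q y)) (fun y => g (q y)) x =
      (mvfderiv 𝓘(ℝ, F') g (q x) : F' →L[ℝ] ℝ)
        (pushforwardBivector (F' := F') π q x (mvfderiv 𝓘(ℝ, F') f (q x) : F' →L[ℝ] ℝ)) := by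
  have h : ∀ k : N → ℝ, MDifferentiableAt 𝓘(ℝ, F') 𝓘(ℝ, ℝ) k (q x) →
      (mvfderiv 𝓘(ℝ, F) (fun y => k (q y)) x : F →L[ℝ] ℝ) =
        (mvfderiv 𝓘(ℝ, F') k (q x) : F' →L[ℝ] ℝ).comp
          (mfderiv 𝓘(ℝ, F) 𝓘(ℝ, F') q x : F →L[ℝ] F') := fun k hk => mfderiv_comp x hk hq
  unfold bracket
  rw [h f hf]
  exact congrArg (fun T : F →L[ℝ] ℝ => T _) (h g hg)

theorem bracket_comp_of_related {π : BivectorField 𝓘(ℝ, F) M} {πN : BivectorField 𝓘(ℝ, F') N}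
    {q : M → N} {x : M} {f g : N → ℝ} (hrel : PoissonRelatedAt π πN q x)
    (hq : MDifferentiableAt 𝓘(ℝ, F) 𝓘(ℝ, F') q x)
    (hf : MDifferentiableAt 𝓘(ℝ, F') 𝓘(ℝ, ℝ) f (q x))
    (hg : MDifferentiableAt 𝓘(ℝ, F') 𝓘(ℝ, ℝ) g (q x)) :
    bracket π (fun y => f (q y)) (fun y => g (q y)) x = bracket πN f g (q x) :=
  (bracket_comp_eq hq hf hg).trans (congrArg (mvfderiv 𝓘(ℝ, F') g (q x)) (hrel _).symm)

end Pushforward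

/-! ### Quotients by a distribution and by a group -/

section Maps

variable {F : Type*} [NormedAddCommGroup F] [NormedSpace ℝ F]
  {F' : Type*} [NormedAddCommGroup F'] [NormedSpace ℝ F']
  {M : Type*} [TopologicalSpace M] [ChartedSpace F M]
  {N : Type*} [TopologicalSpace N] [ChartedSpace F' N]
  {π : BivectorField 𝓘(ℝ, F) M} {D : ∀ x : M, Submodule ℝ (TangentSpace 𝓘(ℝ, F) x)}
  {U : Set M} {q : M → N}

theorem IsDistributionQuotient.contMDiffAt (hq : IsDistributionQuotient (E' := F') D U q)
    {x : M} (hx : x ∈ U) : ContMDiffAt 𝓘(ℝ, F) 𝓘(ℝ, F') ∞ q x :=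
  hq.smooth.contMDiffAt (hq.isOpen.mem_nhds hx)

theorem IsDistributionQuotient.eventually_contMDiffAt_comp
    (hq : IsDistributionQuotient (E' := F') D U q) {x : M} (hx : x ∈ U) {f : N → ℝ}
    (hf : ∀ᶠ y in 𝓝 (q x), ContMDiffAt 𝓘(ℝ, F') 𝓘(ℝ, ℝ) ∞ f y) :
    ∀ᶠ y in 𝓝 x, ContMDiffAt 𝓘(ℝ, F) 𝓘(ℝ, ℝ) ∞ (fun y => f (q y)) y := by
  filter_upwards [hq.isOpen.mem_nhds hx, (hq.contMDiffAt hx).continuousAt.eventually hf]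
    with y hy hfy
  exact hfy.comp y (hq.contMDiffAt hy)

theorem IsDistributionQuotient.mvfderiv_comp_mem
    (hq : IsDistributionQuotient (E' := F') D U q) {x : M} (hx : x ∈ U) {f : N → ℝ}
    (hf : MDifferentiableAt 𝓘(ℝ, F') 𝓘(ℝ, ℝ) f (q x)) :
    mvfderiv 𝓘(ℝ, F) (fun y => f (q y)) x ∈ annihilator 𝓘(ℝ, F) (D x) := by
  intro v hv
  have h := mfderiv_comp x hf ((hq.contMDiffAt hx).mdifferentiableAt (by simp))
  refine (congrArg (fun T : F →L[ℝ] ℝ => T v) h).trans ?_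
  refine (congrArg (mvfderiv 𝓘(ℝ, F') f (q x) : F' → ℝ) ((hq.ker_eq x hx v).2 hv)).trans ?_
  exact map_zero (mvfderiv 𝓘(ℝ, F') f (q x) : F' →L[ℝ] ℝ)

theorem IsDistributionQuotient.bracket_comp_eventuallyEq
    (hq : IsDistributionQuotient (E' := F') D U q) {πN : BivectorField 𝓘(ℝ, F') N}
    (hrel : ∀ x ∈ U, PoissonRelatedAt π πN q x) {x : M} (hx : x ∈ U) {f g : N → ℝ}
    (hf : ContMDiff 𝓘(ℝ, F') 𝓘(ℝ, ℝ) ∞ f) (hg : ContMDiff 𝓘(ℝ, F') 𝓘(ℝ, ℝ) ∞ g) :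
    bracket π (fun y => f (q y)) (fun y => g (q y)) =ᶠ[𝓝 x] fun y => bracket πN f g (q y) := by
  filter_upwards [hq.isOpen.mem_nhds hx] with y hy
  exact bracket_comp_of_related (hrel y hy) ((hq.contMDiffAt hy).mdifferentiableAt (by simp))
    ((hf _).mdifferentiableAt (by simp)) ((hg _).mdifferentiableAt (by simp))

theorem eq_of_poissonRelatedAt {πN πN' : BivectorField 𝓘(ℝ, F') N}
    (hs : ∀ y, ∃ x ∈ U, q x = y) (h : ∀ x ∈ U, PoissonRelatedAt π πN q x)
    (h' : ∀ x ∈ U, PoissonRelatedAt π πN' q x) : πN = πN' := by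
  funext y
  obtain ⟨x, hx, rfl⟩ := hs y
  exact LinearMap.ext fun a => (h x hx a).trans (h' x hx a).symm

/-- The fibres are orbits, hence images of the connected group `K` under orbit maps. -/
theorem IsOrbitQuotient.isDistributionQuotient {E : Type*} [NormedAddCommGroup E] [NormedSpace ℝ E]
    {G : Type*} [TopologicalSpace G] [ChartedSpace E G] [Group G] {K : Subgroup G}
    [MulAction G M] [ContinuousSMul G M] (hK : IsConnected (K : Set G)) {p : M → N}
    (hp : IsOrbitQuotient (F' := F') E F K p) :
    IsDistributionQuotient (E' := F') (orbitDistribution E F K) univ p where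
  isOpen := isOpen_univ
  smooth := hp.smooth.contMDiffOn
  surjective y := (hp.surjective y).imp fun _ h => ⟨mem_univ _, h⟩
  submersion x _ := hp.submersion x
  ker_eq x _ := hp.ker_eq x
  connected_fibre y := by
    obtain ⟨x, rfl⟩ := hp.surjective y
    have h : univ ∩ p ⁻¹' {p x} = (fun g : G => g • x) '' (K : Set G) := by
      ext z
      simp only [univ_inter, mem_preimage, mem_singleton_iff, mem_image, SetLike.mem_coe,
        ← hp.fibre_eq_orbit]
      exact eq_comm
    rw [h]
    exact hK.image _ (by fun_prop)

end Maps

/-! ### Descent of the Poisson structure -/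

section Quotient

variable {F : Type*} [NormedAddCommGroup F] [NormedSpace ℝ F] [FiniteDimensional ℝ F]
  {F' : Type*} [NormedAddCommGroup F'] [NormedSpace ℝ F'] [FiniteDimensional ℝ F']
  {M : Type*} [TopologicalSpace M] [T2Space M] [ChartedSpace F M] [IsManifold 𝓘(ℝ, F) ∞ M]
  {N : Type*} [TopologicalSpace N] [ChartedSpace F' N] [IsManifold 𝓘(ℝ, F') ∞ N]
  {π : BivectorField 𝓘(ℝ, F) M} {D : ∀ x : M, Submodule ℝ (TangentSpace 𝓘(ℝ, F) x)}
  {U : Set M} {q : M → N}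

/-- Locally defined functions whose differentials annihilate `D` are closed under the bracket. -/
def BracketClosed (π : BivectorField 𝓘(ℝ, F) M)
    (D : ∀ x : M, Submodule ℝ (TangentSpace 𝓘(ℝ, F) x)) : Prop :=
  ∀ (f g : M → ℝ) (x : M), (∀ᶠ y in 𝓝 x, ContMDiffAt 𝓘(ℝ, F) 𝓘(ℝ, ℝ) ∞ f y) →
    (∀ᶠ y in 𝓝 x, ContMDiffAt 𝓘(ℝ, F) 𝓘(ℝ, ℝ) ∞ g y) →
    (∀ᶠ y in 𝓝 x, mvfderiv 𝓘(ℝ, F) f y ∈ annihilator 𝓘(ℝ, F) (D y)) →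
    (∀ᶠ y in 𝓝 x, mvfderiv 𝓘(ℝ, F) g y ∈ annihilator 𝓘(ℝ, F) (D y)) →
    mvfderiv 𝓘(ℝ, F) (bracket π f g) x ∈ annihilator 𝓘(ℝ, F) (D x)

/-- The bracket of two functions pulled back from `N` is constant along the fibres. -/
theorem IsDistributionQuotient.bracket_comp_eq_of_eq
    (hq : IsDistributionQuotient (E' := F') D U q) (hM : IsPoisson π) (hπ : BracketClosed π D)
    {f g : N → ℝ} (hf : ContMDiff 𝓘(ℝ, F') 𝓘(ℝ, ℝ) ∞ f) (hg : ContMDiff 𝓘(ℝ, F') 𝓘(ℝ, ℝ) ∞ g)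
    {x x' : M} (hx : x ∈ U) (hx' : x' ∈ U) (h : q x = q x') :
    bracket π (fun y => f (q y)) (fun y => g (q y)) x =
      bracket π (fun y => f (q y)) (fun y => g (q y)) x' := by
  have hsm : ∀ k : N → ℝ, ContMDiff 𝓘(ℝ, F') 𝓘(ℝ, ℝ) ∞ k → ∀ z ∈ U,
      (∀ᶠ y in 𝓝 z, ContMDiffAt 𝓘(ℝ, F) 𝓘(ℝ, ℝ) ∞ (fun y => k (q y)) y) ∧
      ∀ᶠ y in 𝓝 z, mvfderiv 𝓘(ℝ, F) (fun y => k (q y)) y ∈ annihilator 𝓘(ℝ, F) (D y) :=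
    fun k hk z hz => ⟨hq.eventually_contMDiffAt_comp hz (Eventually.of_forall fun y => hk y),
      eventually_of_mem (hq.isOpen.mem_nhds hz) fun y hy =>
        hq.mvfderiv_comp_mem hy ((hk _).mdifferentiableAt (by simp))⟩
  -- Equality of values is transitive and, near each point of the fibre, holds along it;
  -- connectedness makes it hold between any two points.
  refine (hq.connected_fibre (q x')).isPreconnected.induction₂' (fun y z =>
    bracket π (fun y => f (q y)) (fun y => g (q y)) y =
      bracket π (fun y => f (q y)) (fun y => g (q y)) z) ?_
      (fun _ _ _ _ _ _ => Eq.trans) ⟨hx, h⟩ ⟨hx', rfl⟩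
  rintro z ⟨hz, hqz⟩
  have hzU := hq.isOpen.mem_nhds hz
  have key := eventually_eq_of_fibre (h := bracket π (fun y => f (q y)) (fun y => g (q y)))
    (eventually_of_mem hzU fun y hy => hq.contMDiffAt hy) (hq.submersion z hz)
    (eventually_of_mem hzU fun y hy => (hM.contMDiffAt_bracket (hsm f hf y hy).1
      (hsm g hg y hy).1).mdifferentiableAt (by simp))
    (eventually_of_mem hzU fun y hy v hv => hπ _ _ y (hsm f hf y hy).1 (hsm g hg y hy).1
      (hsm f hf y hy).2 (hsm g hg y hy).2 v ((hq.ker_eq y hy v).1 hv))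
  filter_upwards [nhdsWithin_le_nhds key, self_mem_nhdsWithin] with y hy hyf
  have := hy (hyf.2.trans hqz.symm)
  exact ⟨this.symm, this⟩

/-- Covectors on `N` are differentials of global functions, so the pushforward is determined by
brackets of pulled-back functions, which are constant on fibres. -/
theorem IsDistributionQuotient.pushforwardBivector_eq [T2Space N]
    (hq : IsDistributionQuotient (E' := F') D U q) (hM : IsPoisson π) (hπ : BracketClosed π D)
    {x x' : M} (hx : x ∈ U) (hx' : x' ∈ U) (h : q x = q x') :
    pushforwardBivector (F' := F') π q x = pushforwardBivector π q x' := by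
  ext a
  refine (SeparatingDual.eq_iff_forall_dual_eq (R := ℝ)).2 fun b => ?_
  obtain ⟨f, hf, hfa⟩ := exists_mvfderiv_eq (E := F') (q x) a
  obtain ⟨g, hg, hgb⟩ := exists_mvfderiv_eq (E := F') (q x) b
  have hd : ∀ {k : N → ℝ}, ContMDiff 𝓘(ℝ, F') 𝓘(ℝ, ℝ) ∞ k → ∀ y,
      MDifferentiableAt 𝓘(ℝ, F') 𝓘(ℝ, ℝ) k y := fun hk y => (hk y).mdifferentiableAt (by simp)
  have key : ∀ z ∈ U, q z = q x → bracket π (fun y => f (q y)) (fun y => g (q y)) z =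
      b (pushforwardBivector π q z a) := by
    intro z hz hzx
    refine (bracket_comp_eq ((hq.contMDiffAt hz).mdifferentiableAt (by simp))
      (hd hf _) (hd hg _)).trans ?_
    have h1 : ∀ y, y = q x → (mvfderiv 𝓘(ℝ, F') f y : F' →L[ℝ] ℝ) = a := by rintro y rfl; exact hfa
    have h2 : ∀ y, y = q x → (mvfderiv 𝓘(ℝ, F') g y : F' →L[ℝ] ℝ) = b := by rintro y rfl; exact hgb
    exact (congrArg (fun T : F' →L[ℝ] ℝ => T _) (h2 _ hzx)).trans
      (congrArg (fun c => b (pushforwardBivector π q z c)) (h1 _ hzx))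
  rw [← key x hx rfl, ← key x' hx' h.symm]
  exact hq.bracket_comp_eq_of_eq hM hπ hf hg hx hx' h

/-- Any set-theoretic section of `q` may define the bivector, as the pushforward is independent of
the point in the fibre. -/
theorem IsDistributionQuotient.exists_related [T2Space N]
    (hq : IsDistributionQuotient (E' := F') D U q) (hM : IsPoisson π) (hπ : BracketClosed π D) :
    ∃ πN : BivectorField 𝓘(ℝ, F') N, ∀ x ∈ U, PoissonRelatedAt π πN q x := by
  choose s hsU hs using hq.surjective
  refine ⟨fun y => pushforwardBivector (F' := F') π q (s y), fun x hx a => ?_⟩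
  exact congrArg (fun T : (F' →L[ℝ] ℝ) →ₗ[ℝ] F' => T a)
    (hq.pushforwardBivector_eq hM hπ (hsU _) hx (hs _))

/-- On `U` the bracket of pulled-back functions is the pullback of the bracket. Composing with a
smooth local section of `q` gives smoothness on `N`; the Jacobi identity is read off at a point
above, in its germ version because pullbacks are controlled only on `U`. -/
theorem IsDistributionQuotient.isPoisson_of_related
    (hq : IsDistributionQuotient (E' := F') D U q) (hM : IsPoisson π)
    {πN : BivectorField 𝓘(ℝ, F') N} (hrel : ∀ x ∈ U, PoissonRelatedAt π πN q x) :
    IsPoisson πN := by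
  have hsmooth : ∀ f g : N → ℝ, ContMDiff 𝓘(ℝ, F') 𝓘(ℝ, ℝ) ∞ f →
      ContMDiff 𝓘(ℝ, F') 𝓘(ℝ, ℝ) ∞ g → ContMDiff 𝓘(ℝ, F') 𝓘(ℝ, ℝ) ∞ (bracket πN f g) := by
    intro f g hf hg y
    obtain ⟨x, hx, rfl⟩ := hq.surjective y
    obtain ⟨s, hs, hsx, hqs⟩ := exists_local_section (hq.contMDiffAt hx) (hq.submersion x hx)
    have h1 : ContMDiffAt 𝓘(ℝ, F) 𝓘(ℝ, ℝ) ∞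
        (bracket π (fun y => f (q y)) (fun y => g (q y))) x := hM.contMDiffAt_bracket
      (hq.eventually_contMDiffAt_comp hx (Eventually.of_forall fun y => hf y))
      (hq.eventually_contMDiffAt_comp hx (Eventually.of_forall fun y => hg y))
    have h2 : ContMDiffAt 𝓘(ℝ, F') 𝓘(ℝ, ℝ) ∞
        (fun y => bracket π (fun y => f (q y)) (fun y => g (q y)) (s y)) (q x) :=
      ContMDiffAt.comp (q x) (by rwa [hsx]) hs
    refine h2.congr_of_eventuallyEq ?_
    have hs' := hs.continuousAt.tendsto
    rw [hsx] at hs'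
    filter_upwards [hqs, hs'.eventually (hq.bracket_comp_eventuallyEq hrel hx hf hg)] with y h3 h4
    rw [h4, h3]
  refine ⟨fun y a => ?_, hsmooth, fun f g h hf hg hh y => ?_⟩
  · obtain ⟨x, hx, rfl⟩ := hq.surjective y
    rw [hrel x hx a]
    exact hM.alternating x ((a : F' →L[ℝ] ℝ).comp
      (mfderiv 𝓘(ℝ, F) 𝓘(ℝ, F') q x : F →L[ℝ] F'))
  · obtain ⟨x, hx, rfl⟩ := hq.surjective y
    have key : ∀ f g h : N → ℝ, ContMDiff 𝓘(ℝ, F') 𝓘(ℝ, ℝ) ∞ f →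
        ContMDiff 𝓘(ℝ, F') 𝓘(ℝ, ℝ) ∞ g → ContMDiff 𝓘(ℝ, F') 𝓘(ℝ, ℝ) ∞ h →
        bracket πN f (bracket πN g h) (q x) = bracket π (fun y => f (q y))
          (bracket π (fun y => g (q y)) (fun y => h (q y))) x := fun f g h hf hg hh => by
      rw [bracket_congr π (EventuallyEq.refl _ _) (hq.bracket_comp_eventuallyEq hrel hx hg hh)]
      exact (hq.bracket_comp_eventuallyEq hrel hx hf (hsmooth g h hg hh)).self_of_nhds.symm
    rw [key f g h hf hg hh, key g h f hg hh hf, key h f g hh hf hg]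
    exact hM.jacobi_of_eventually
      (hq.eventually_contMDiffAt_comp hx (Eventually.of_forall fun y => hf y))
      (hq.eventually_contMDiffAt_comp hx (Eventually.of_forall fun y => hg y))
      (hq.eventually_contMDiffAt_comp hx (Eventually.of_forall fun y => hh y))

theorem IsDistributionQuotient.existsUnique_isPoisson [T2Space N]
    (hq : IsDistributionQuotient (E' := F') D U q) (hM : IsPoisson π) (hπ : BracketClosed π D) :
    ∃! πN : BivectorField 𝓘(ℝ, F') N, IsPoisson πN ∧ ∀ x ∈ U, PoissonRelatedAt π πN q x := by
  obtain ⟨πN, hrel⟩ := hq.exists_related hM hπ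
  exact ⟨πN, ⟨hq.isPoisson_of_related hM hrel, hrel⟩,
    fun πN' h => eq_of_poissonRelatedAt hq.surjective h.2 hrel⟩

end Quotient

end PoissonReduction

end

/-! ### The theorem -/

open scoped Manifold ContDiff in
open PoissonReduction in
theorem proposition7p4
    {E : Type*} [NormedAddCommGroup E] [NormedSpace ℝ E] [FiniteDimensional ℝ E]
    {F : Type*} [NormedAddCommGroup F] [NormedSpace ℝ F] [FiniteDimensional ℝ F]
    -- the Poisson Lie group
    {G : Type*} [TopologicalSpace G] [T2Space G] [ChartedSpace E G] [Group G]
    [LieGroup 𝓘(ℝ, E) ∞ G]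
    (πG : BivectorField 𝓘(ℝ, E) G) (hG : IsPoissonLie πG)
    -- the Poisson manifold
    {M : Type*} [TopologicalSpace M] [T2Space M] [ChartedSpace F M] [IsManifold 𝓘(ℝ, F) ∞ M]
    [Nonempty M]
    (π : BivectorField 𝓘(ℝ, F) M) (hM : IsPoisson π)
    -- the Poisson action
    [MulAction G M] [ContMDiffSMul 𝓘(ℝ, E) 𝓘(ℝ, F) ∞ G M] (hact : IsPoissonAction πG π)
    -- the closed subgroup, whose orbits define a distribution on `M`
    (K : Subgroup G) (hK : IsClosed (K : Set G))
    (hrank : IsLocallyConstant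
      (fun x : M => Module.finrank ℝ (orbitDistribution E F K x))) :
    (IsDualSubalgebra πG (annihilator 𝓘(ℝ, E) (subgroupLieAlgebra (E := E) K)) →
      -- the annihilator of the orbit distribution is a subalgebroid
      IsSubalgebroid π (fun x => annihilator 𝓘(ℝ, F) (orbitDistribution E F K x)) ∧
      -- functions on open sets that are constant along the distribution are closed under the bracket
      (∀ U : Set M, IsOpen U → ∀ f g : M → ℝ,
        ContMDiffOn 𝓘(ℝ, F) 𝓘(ℝ, ℝ) ∞ f U → ContMDiffOn 𝓘(ℝ, F) 𝓘(ℝ, ℝ) ∞ g U →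
        (∀ x ∈ U, mvfderiv 𝓘(ℝ, F) f x ∈
          annihilator 𝓘(ℝ, F) (orbitDistribution E F K x)) →
        (∀ x ∈ U, mvfderiv 𝓘(ℝ, F) g x ∈
          annihilator 𝓘(ℝ, F) (orbitDistribution E F K x)) →
        ∀ x ∈ U, mvfderiv 𝓘(ℝ, F) (bracket π f g) x ∈
          annihilator 𝓘(ℝ, F) (orbitDistribution E F K x)) ∧
      -- the Poisson structure descends to quotient manifolds
      (∀ {F' : Type*} [NormedAddCommGroup F'] [NormedSpace ℝ F'] [FiniteDimensional ℝ F']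
        {N : Type*} [TopologicalSpace N] [T2Space N] [ChartedSpace F' N]
        [IsManifold 𝓘(ℝ, F') ∞ N],
        -- local quotients by the distribution
        (∀ (U : Set M) (q : M → N),
          IsDistributionQuotient (E' := F') (orbitDistribution E F K) U q →
          ∃! πN : BivectorField 𝓘(ℝ, F') N, IsPoisson πN ∧
            ∀ x ∈ U, PoissonRelatedAt π πN q x) ∧
        -- the orbit space `M / K`, if `K` is connected
        (IsConnected (K : Set G) → ∀ p : M → N, IsOrbitQuotient (F' := F') E F K p →
          ∃! πN : BivectorField 𝓘(ℝ, F') N, IsPoisson πN ∧ IsPoissonMap π πN p))) ∧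
    ((∀ x : M, isotropyAlgebra E F G x ≤ subgroupLieAlgebra (E := E) K) →
      IsSubalgebroid π (fun x => annihilator 𝓘(ℝ, F) (orbitDistribution E F K x)) →
      IsDualSubalgebra πG (annihilator 𝓘(ℝ, E) (subgroupLieAlgebra (E := E) K))) ∧
    -- in particular for locally free actions
    ((∀ x : M, isotropyAlgebra E F G x = ⊥) →
      IsSubalgebroid π (fun x => annihilator 𝓘(ℝ, F) (orbitDistribution E F K x)) →
      IsDualSubalgebra πG (annihilator 𝓘(ℝ, E) (subgroupLieAlgebra (E := E) K))) := by
  have hbr : IsDualSubalgebra πG (annihilator 𝓘(ℝ, E) (subgroupLieAlgebra (E := E) K)) →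
      BracketClosed π (orbitDistribution E F K) :=
    fun hd f g x hf hg hfD hgD => mvfderiv_bracket_mem_annihilator hG hM hact hd hf hg hfD hgD
  refine ⟨fun hd => ⟨isSubalgebroid_annihilator hG hM hact hrank hd, ?_, ?_⟩,
    isDualSubalgebra_of_isSubalgebroid hG hM hact,
    fun hfree => isDualSubalgebra_of_isSubalgebroid hG hM hact fun x => (hfree x).trans_le bot_le⟩
  · intro U hU f g hf hg hfD hgD x hx
    have hUx := hU.mem_nhds hx
    exact hbr hd f g x (Filter.eventually_of_mem hUx fun y hy => hf.contMDiffAt (hU.mem_nhds hy))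
      (Filter.eventually_of_mem hUx fun y hy => hg.contMDiffAt (hU.mem_nhds hy))
      (Filter.eventually_of_mem hUx hfD) (Filter.eventually_of_mem hUx hgD)
  · intro F' _ _ _ N _ _ _ _
    refine ⟨fun U q hq => hq.existsUnique_isPoisson hM (hbr hd), fun hconn p hp => ?_⟩
    have : ContinuousSMul G M :=
      ⟨(ContMDiffSMul.contMDiff_smul (I := 𝓘(ℝ, E)) (I' := 𝓘(ℝ, F)) (n := ∞)).continuous⟩
    obtain ⟨πN, ⟨hπN, hrel⟩, huniq⟩ :=
      (hp.isDistributionQuotient hconn).existsUnique_isPoisson hM (hbr hd)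
    exact ⟨πN, ⟨hπN, hp.smooth, fun x => hrel x (Set.mem_univ x)⟩,
      fun πN' h => huniq πN' ⟨h.1, fun x _ => h.2.related x⟩⟩
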